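/- Let $G$ be a finitely generated, torsion-free group that is nilpotent of class at most $2$ (that is, $[G,G]\subseteq Z(G)$), regarded as a discrete group, and let $C^*(G)$ be its full group $C^*$-algebra. Then the following four conditions are equivalent: (a) $\operatorname{rank}(G/Z(G))+\operatorname{rank} Z(G)\le 1$, where $\operatorname{rank}$ denotes the rank of an abelian group, i.e. the maximal number of $\mathbb Z$-linearly independent elements; (b) $G\cong\mathbb Z$ or $G$ is the trivial group; (c) $G$ is $C^*$-stable, i.e. the separable $C^*$-algebra $C^*(G)$ is semiprojective: for every separable $C^*$-algebra $B$, every increasing sequence $J_1\subseteq J_2\subseteq\cdots$ of (closed, two-sided) ideals of $B$ and every $*$-homomorphism $\varphi\colon C^*(G)\to B/\overline{\bigcup_k J_k}$, there are $n\in\mathbb N$ and a $*$-homomorphism $\psi\colon C^*(G)\to B/J_n$ such that $\pi_{n,\infty}\circ\psi=\varphi$, where $\pi_{n,\infty}\colon B/J_n\to B/\overline{\bigcup_k J_k}$ is the natural quotient map; (d) $G$ is matricially stable, i.e. the separable $C^*$-algebra $C^*(G)$ is matricially (weakly) semiprojective: for every sequence of positive integers $k_1,k_2,\dots$ and every $*$-homomorphism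 $\varphi\colon C^*(G)\to\prod_n M_{k_n}(\mathbb C)/\bigoplus_n M_{k_n}(\mathbb C)$ there is a $*$-homomorphism $\psi\colon C^*(G)\to\prod_n M_{k_n}(\mathbb C)$ such that $\rho\circ\psi=\varphi$, where $\rho$ is the natural quotient map. Here $\prod_n$ denotes the $C^*$-algebra of bounded sequences and $\bigoplus_n$ its ideal of sequences converging to $0$ in norm. $C^*$-algebras are not assumed unital, and $*$-homomorphisms are not assumed to preserve units. -/

import Mathlib

open Filter Topology TopologicalSpace UniformSpace
open scoped Matrix.Norms.L2Operator

noncomputable section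

/-! ## The full group C*-algebra -/

/-- The complex group algebra `ℂ[G]` of a discrete group `G`; it is equipped below with the
involution `(∑ a_g g)* = ∑ conj(a_g) g⁻¹` and with its largest C*-seminorm. -/
def GroupStarAlgebra (G : Type*) [Group G] : Type _ := MonoidAlgebra ℂ G

namespace GroupStarAlgebra

variable {G : Type*} [Group G]

instance : Ring (GroupStarAlgebra G) := inferInstanceAs (Ring (MonoidAlgebra ℂ G))

instance : Algebra ℂ (GroupStarAlgebra G) := inferInstanceAs (Algebra ℂ (MonoidAlgebra ℂ G))

/-- The element `c • g` of the group algebra. -/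
def single (g : G) (c : ℂ) : GroupStarAlgebra G := MonoidAlgebra.single g c

theorem induction {P : GroupStarAlgebra G → Prop} (x : GroupStarAlgebra G) (zero : P 0)
    (add : ∀ x y, P x → P y → P (x + y)) (single : ∀ g c, P (single g c)) : P x :=
  MonoidAlgebra.induction_linear (motive := P) x zero add single

theorem single_mul_single (g h : G) (c d : ℂ) :
    single g c * single h d = single (g * h) (c * d) :=
  MonoidAlgebra.single_mul_single g h c d

theorem smul_single (a : ℂ) (g : G) (c : ℂ) : a • single g c = single g (a * c) :=
  MonoidAlgebra.smul_single a g c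

theorem one_def : (1 : GroupStarAlgebra G) = single 1 1 := rfl

/-- The involution on the group algebra, as an additive map: it sends `c • g` to
`conj c • g⁻¹`. -/
def starAddHom : GroupStarAlgebra G →+ GroupStarAlgebra G :=
  (Finsupp.liftAddHom fun g : G =>
    (MonoidAlgebra.singleAddHom g⁻¹ : ℂ →+ MonoidAlgebra ℂ G).comp
      (starAddEquiv : ℂ ≃+ ℂ).toAddMonoidHom).comp
    (MonoidAlgebra.coeffAddEquiv : MonoidAlgebra ℂ G ≃+ (G →₀ ℂ)).toAddMonoidHom

theorem starAddHom_single (g : G) (c : ℂ) : starAddHom (single g c) = single g⁻¹ (star c) := by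
  change (Finsupp.liftAddHom fun g : G =>
    (MonoidAlgebra.singleAddHom g⁻¹ : ℂ →+ MonoidAlgebra ℂ G).comp
      (starAddEquiv : ℂ ≃+ ℂ).toAddMonoidHom) (Finsupp.single g c) = _
  rw [Finsupp.liftAddHom_apply_single]
  rfl

instance : StarRing (GroupStarAlgebra G) where
  star := starAddHom
  star_involutive x := by
    induction x using induction with
    | zero => simp
    | add x y hx hy => simp [hx, hy]
    | single g c => simp [starAddHom_single]
  star_add := map_add starAddHom
  star_mul x y := by
    change starAddHom (x * y) = starAddHom y * starAddHom x
    induction x using induction with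
    | zero => simp
    | add x x' hx hx' => simp [add_mul, mul_add, hx, hx']
    | single g c =>
      induction y using induction with
      | zero => simp
      | add y y' hy hy' => simp [add_mul, mul_add, hy, hy']
      | single h d => simp [single_mul_single, starAddHom_single, mul_comm]

theorem star_single (g : G) (c : ℂ) : star (single g c) = single g⁻¹ (star c) :=
  starAddHom_single g c

instance : StarModule ℂ (GroupStarAlgebra G) where
  star_smul a x := by
    induction x using induction with
    | zero => simp
    | add x y hx hy => simp only [smul_add, star_add, hx, hy]
    | single g c => simp [smul_single, star_single]

/-- C*-seminorms on the group algebra. These are exactly the functions `x ↦ ‖π x‖` for a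
`*`-homomorphism `π` from the group algebra to a C*-algebra (equivalently, to the bounded
operators on a Hilbert space). -/
structure IsCStarSeminorm (p : Seminorm ℂ (GroupStarAlgebra G)) : Prop where
  map_mul_le : ∀ x y, p (x * y) ≤ p x * p y
  map_star : ∀ x, p (star x) = p x
  map_star_mul_self : ∀ x, p (star x * x) = p x ^ 2

theorem IsCStarSeminorm.single_le {p : Seminorm ℂ (GroupStarAlgebra G)}
    (hp : IsCStarSeminorm p) (g : G) (c : ℂ) : p (single g c) ≤ ‖c‖ := by
  have h1 : p 1 ≤ 1 := by
    have h := hp.map_star_mul_self 1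
    rw [star_one, one_mul] at h
    nlinarith [apply_nonneg p 1]
  have h2 : p (single g 1) ≤ 1 := by
    have h := hp.map_star_mul_self (single g 1)
    have h3 : star (single g (1 : ℂ)) * single g 1 = 1 := by
      simp [star_single, single_mul_single, one_def]
    rw [h3] at h
    nlinarith [apply_nonneg p (single g 1)]
  have h4 : single g c = c • single g 1 := by simp [smul_single]
  rw [h4, map_smul_eq_mul]
  exact mul_le_of_le_one_right (norm_nonneg c) h2

theorem exists_bound (x : GroupStarAlgebra G) :
    ∃ C : ℝ, ∀ p : Seminorm ℂ (GroupStarAlgebra G), IsCStarSeminorm p → p x ≤ C := by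
  induction x using induction with
  | zero => exact ⟨0, fun p _ => by simp⟩
  | add x y hx hy =>
    obtain ⟨C, hC⟩ := hx
    obtain ⟨D, hD⟩ := hy
    exact ⟨C + D, fun p hp => (map_add_le_add p x y).trans (add_le_add (hC p hp) (hD p hp))⟩
  | single g c => exact ⟨‖c‖, fun p hp => hp.single_le g c⟩

/-- The largest C*-seminorm on the group algebra, the supremum of all C*-seminorms. -/
def maxNorm (x : GroupStarAlgebra G) : ℝ :=
  ⨆ p : {p : Seminorm ℂ (GroupStarAlgebra G) // IsCStarSeminorm p}, p.1 x

theorem isCStarSeminorm_zero : IsCStarSeminorm (0 : Seminorm ℂ (GroupStarAlgebra G)) :=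
  ⟨by simp, by simp, by simp⟩

instance : Nonempty {p : Seminorm ℂ (GroupStarAlgebra G) // IsCStarSeminorm p} :=
  ⟨⟨0, isCStarSeminorm_zero⟩⟩

theorem le_maxNorm {p : Seminorm ℂ (GroupStarAlgebra G)} (hp : IsCStarSeminorm p)
    (x : GroupStarAlgebra G) : p x ≤ maxNorm x := by
  obtain ⟨C, hC⟩ := exists_bound x
  exact le_ciSup
    (f := fun p : {p : Seminorm ℂ (GroupStarAlgebra G) // IsCStarSeminorm p} => p.1 x)
    ⟨C, by rintro _ ⟨q, rfl⟩; exact hC q.1 q.2⟩ ⟨p, hp⟩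

theorem maxNorm_le {x : GroupStarAlgebra G} {C : ℝ}
    (h : ∀ p : Seminorm ℂ (GroupStarAlgebra G), IsCStarSeminorm p → p x ≤ C) :
    maxNorm x ≤ C :=
  ciSup_le fun p => h p.1 p.2

theorem maxNorm_nonneg (x : GroupStarAlgebra G) : 0 ≤ maxNorm x := by
  simpa using le_maxNorm isCStarSeminorm_zero x

theorem maxNorm_star_le (x : GroupStarAlgebra G) : maxNorm (star x) ≤ maxNorm x :=
  maxNorm_le fun p hp => (hp.map_star x).le.trans (le_maxNorm hp x)

theorem maxNorm_star (x : GroupStarAlgebra G) : maxNorm (star x) = maxNorm x :=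
  (maxNorm_star_le x).antisymm (by simpa using maxNorm_star_le (star x))

theorem maxNorm_mul_le (x y : GroupStarAlgebra G) :
    maxNorm (x * y) ≤ maxNorm x * maxNorm y :=
  maxNorm_le fun p hp => (hp.map_mul_le x y).trans
    (mul_le_mul (le_maxNorm hp x) (le_maxNorm hp y) (apply_nonneg p y) (maxNorm_nonneg x))

theorem sq_maxNorm_le (x : GroupStarAlgebra G) : maxNorm x * maxNorm x ≤ maxNorm (star x * x) := by
  have h : maxNorm x ≤ Real.sqrt (maxNorm (star x * x)) :=
    maxNorm_le fun p hp => Real.le_sqrt_of_sq_le <| by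
      rw [← hp.map_star_mul_self]
      exact le_maxNorm hp _
  have h2 := mul_self_le_mul_self (maxNorm_nonneg x) h
  rwa [Real.mul_self_sqrt (maxNorm_nonneg _)] at h2

theorem maxNorm_smul_le (c : ℂ) (x : GroupStarAlgebra G) : maxNorm (c • x) ≤ ‖c‖ * maxNorm x :=
  maxNorm_le fun p hp => by
    rw [map_smul_eq_mul]
    exact mul_le_mul_of_nonneg_left (le_maxNorm hp x) (norm_nonneg c)

/-- The largest C*-seminorm, bundled as a seminorm of the additive group. -/
def maxAddGroupSeminorm : AddGroupSeminorm (GroupStarAlgebra G) where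
  toFun := maxNorm
  map_zero' := le_antisymm (maxNorm_le fun p _ => (map_zero p).le) (maxNorm_nonneg 0)
  add_le' x y := maxNorm_le fun p hp =>
    (map_add_le_add p x y).trans (add_le_add (le_maxNorm hp x) (le_maxNorm hp y))
  neg' x := by
    have h : ∀ y : GroupStarAlgebra G, maxNorm (-y) ≤ maxNorm y := fun y =>
      maxNorm_le fun p hp => by
        rw [map_neg_eq_map]
        exact le_maxNorm hp y
    exact (h x).antisymm (by simpa using h (-x))

instance : SeminormedRing (GroupStarAlgebra G) where
  __ := (inferInstance : Ring (GroupStarAlgebra G))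
  __ := (maxAddGroupSeminorm (G := G)).toSeminormedAddCommGroup
  norm_mul_le := maxNorm_mul_le

theorem norm_def (x : GroupStarAlgebra G) : ‖x‖ = maxNorm x := rfl

instance : NormedSpace ℂ (GroupStarAlgebra G) where
  norm_smul_le := maxNorm_smul_le

theorem isometry_star : Isometry (star : GroupStarAlgebra G → GroupStarAlgebra G) :=
  AddMonoidHomClass.isometry_of_norm (starAddEquiv : GroupStarAlgebra G ≃+ GroupStarAlgebra G)
    maxNorm_star

end GroupStarAlgebra

/-- The full group C*-algebra `C*(G)` of a discrete group `G`: the (Hausdorff) completion of the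
group algebra `ℂ[G]` with respect to its largest C*-seminorm. -/
def GroupCStarAlgebra (G : Type*) [Group G] : Type _ := Completion (GroupStarAlgebra G)

namespace GroupCStarAlgebra

variable {G : Type*} [Group G]

instance : NormedRing (GroupCStarAlgebra G) :=
  inferInstanceAs (NormedRing (Completion (GroupStarAlgebra G)))

instance : CompleteSpace (GroupCStarAlgebra G) :=
  inferInstanceAs (CompleteSpace (Completion (GroupStarAlgebra G)))

/-- The canonical map `ℂ[G] → C*(G)`. -/
def ofAlg (x : GroupStarAlgebra G) : GroupCStarAlgebra G := (x : Completion (GroupStarAlgebra G))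

theorem ofAlg_add (x y : GroupStarAlgebra G) : ofAlg (x + y) = ofAlg x + ofAlg y :=
  Completion.coe_add x y

theorem ofAlg_mul (x y : GroupStarAlgebra G) : ofAlg (x * y) = ofAlg x * ofAlg y :=
  Completion.coe_mul x y

theorem norm_ofAlg (x : GroupStarAlgebra G) : ‖ofAlg x‖ = ‖x‖ := Completion.norm_coe x

theorem continuous_ofAlg : Continuous (ofAlg : GroupStarAlgebra G → GroupCStarAlgebra G) :=
  Completion.continuous_coe _

theorem denseRange_ofAlg : DenseRange (ofAlg : GroupStarAlgebra G → GroupCStarAlgebra G) :=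
  Completion.denseRange_coe

instance : NormedAlgebra ℂ (GroupCStarAlgebra G) where
  __ := (inferInstance : Algebra ℂ (Completion (GroupStarAlgebra G)))
  norm_smul_le := norm_smul_le (α := ℂ) (β := Completion (GroupStarAlgebra G))

theorem ofAlg_smul (c : ℂ) (x : GroupStarAlgebra G) : ofAlg (c • x) = c • ofAlg x :=
  Completion.coe_smul c x

/-- The involution of `C*(G)`: the continuous extension of the involution of `ℂ[G]`. -/
instance : Star (GroupCStarAlgebra G) where
  star := Completion.map (star : GroupStarAlgebra G → GroupStarAlgebra G)

theorem continuous_star' : Continuous (star : GroupCStarAlgebra G → GroupCStarAlgebra G) :=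
  Completion.continuous_map

theorem star_ofAlg (x : GroupStarAlgebra G) : star (ofAlg x) = ofAlg (star x) :=
  Completion.map_coe GroupStarAlgebra.isometry_star.uniformContinuous x

instance : StarRing (GroupCStarAlgebra G) where
  star_involutive x := by
    induction x using denseRange_ofAlg.induction_on with
    | hp => exact isClosed_eq (continuous_star'.comp continuous_star') continuous_id
    | ih x => simp [star_ofAlg]
  star_add x y := by
    induction x, y using denseRange_ofAlg.induction_on₂ with
    | hp =>
      exact isClosed_eq (continuous_star'.comp continuous_add)
        ((continuous_star'.comp continuous_fst).add (continuous_star'.comp continuous_snd))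
    | h x y => simp [star_ofAlg, ← ofAlg_add]
  star_mul x y := by
    induction x, y using denseRange_ofAlg.induction_on₂ with
    | hp =>
      exact isClosed_eq (continuous_star'.comp continuous_mul)
        ((continuous_star'.comp continuous_snd).mul (continuous_star'.comp continuous_fst))
    | h x y => simp [star_ofAlg, ← ofAlg_mul]

instance : CStarAlgebra (GroupCStarAlgebra G) where
  norm_mul_self_le x := by
    induction x using denseRange_ofAlg.induction_on with
    | hp =>
      exact isClosed_le (continuous_norm.mul continuous_norm)
        (continuous_norm.comp (continuous_star'.mul continuous_id))
    | ih x =>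
      rw [star_ofAlg, ← ofAlg_mul, norm_ofAlg, norm_ofAlg]
      exact GroupStarAlgebra.sq_maxNorm_le x
  star_smul c x := by
    induction x using denseRange_ofAlg.induction_on with
    | hp =>
      exact isClosed_eq (continuous_star'.comp (continuous_const_smul c))
        (continuous_star'.const_smul (star c))
    | ih x => rw [← ofAlg_smul, star_ofAlg, star_ofAlg, star_smul, ofAlg_smul]

end GroupCStarAlgebra

/-! ## Ideals and quotients of C*-algebras -/

/-- An ideal of a (not necessarily unital) C*-algebra: a closed two-sided ideal. (A closed
two-sided ideal of a C*-algebra is automatically closed under scalars and under the involution;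
these two closure properties are recorded in the structure.) -/
structure CStarIdeal (B : Type*) [NonUnitalCStarAlgebra B] extends Submodule ℂ B where
  mul_mem_left' : ∀ a {x : B}, x ∈ carrier → a * x ∈ carrier
  mul_mem_right' : ∀ a {x : B}, x ∈ carrier → x * a ∈ carrier
  star_mem' : ∀ {x : B}, x ∈ carrier → star x ∈ carrier
  isClosed' : IsClosed carrier

namespace CStarIdeal

variable {B : Type*} [NonUnitalCStarAlgebra B]

/-- The quotient `*`-algebra `B / J`. -/
def Quot (J : CStarIdeal B) : Type _ := B ⧸ J.toSubmodule

variable (J : CStarIdeal B)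

instance : AddCommGroup J.Quot := inferInstanceAs (AddCommGroup (B ⧸ J.toSubmodule))

instance : Module ℂ J.Quot := inferInstanceAs (Module ℂ (B ⧸ J.toSubmodule))

/-- The class of `b` in `B / J`. -/
def toQuot (b : B) : J.Quot := J.toSubmodule.mkQ b

theorem toQuot_surjective : Function.Surjective J.toQuot := J.toSubmodule.mkQ_surjective

theorem toQuot_eq_toQuot {x y : B} : J.toQuot x = J.toQuot y ↔ x - y ∈ J.toSubmodule :=
  Submodule.Quotient.eq J.toSubmodule

theorem toQuot_zero : J.toQuot 0 = 0 := rfl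

theorem toQuot_add (x y : B) : J.toQuot (x + y) = J.toQuot x + J.toQuot y := rfl

theorem toQuot_smul (c : ℂ) (x : B) : J.toQuot (c • x) = c • J.toQuot x := rfl

instance : Mul J.Quot where
  mul := Quotient.map₂ (· * ·) fun x x' hx y y' hy => by
    have hx' := (Submodule.quotientRel_def J.toSubmodule).1 hx
    have hy' := (Submodule.quotientRel_def J.toSubmodule).1 hy
    refine (Submodule.quotientRel_def J.toSubmodule).2 ?_
    have h : x * y - x' * y' = (x - x') * y + x' * (y - y') := by
      rw [sub_mul, mul_sub]; abel
    rw [h]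
    exact J.add_mem (J.mul_mem_right' y hx') (J.mul_mem_left' x' hy')

instance : Star J.Quot where
  star := Quotient.map star fun x x' hx => by
    have hx' := (Submodule.quotientRel_def J.toSubmodule).1 hx
    refine (Submodule.quotientRel_def J.toSubmodule).2 ?_
    rw [← star_sub]
    exact J.star_mem' hx'

theorem toQuot_mul (x y : B) : J.toQuot (x * y) = J.toQuot x * J.toQuot y := rfl

theorem toQuot_star (x : B) : J.toQuot (star x) = star (J.toQuot x) := rfl

instance : NonUnitalRing J.Quot where
  left_distrib a b c := by
    obtain ⟨a, rfl⟩ := J.toQuot_surjective a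
    obtain ⟨b, rfl⟩ := J.toQuot_surjective b
    obtain ⟨c, rfl⟩ := J.toQuot_surjective c
    simp only [← toQuot_add, ← toQuot_mul, mul_add]
  right_distrib a b c := by
    obtain ⟨a, rfl⟩ := J.toQuot_surjective a
    obtain ⟨b, rfl⟩ := J.toQuot_surjective b
    obtain ⟨c, rfl⟩ := J.toQuot_surjective c
    simp only [← toQuot_add, ← toQuot_mul, add_mul]
  zero_mul a := by
    obtain ⟨a, rfl⟩ := J.toQuot_surjective a
    rw [← toQuot_zero, ← toQuot_mul, zero_mul]
  mul_zero a := by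
    obtain ⟨a, rfl⟩ := J.toQuot_surjective a
    rw [← toQuot_zero, ← toQuot_mul, mul_zero]
  mul_assoc a b c := by
    obtain ⟨a, rfl⟩ := J.toQuot_surjective a
    obtain ⟨b, rfl⟩ := J.toQuot_surjective b
    obtain ⟨c, rfl⟩ := J.toQuot_surjective c
    simp only [← toQuot_mul, mul_assoc]

instance : StarRing J.Quot where
  star_involutive a := by
    obtain ⟨a, rfl⟩ := J.toQuot_surjective a
    rw [← toQuot_star, ← toQuot_star, star_star]
  star_mul a b := by
    obtain ⟨a, rfl⟩ := J.toQuot_surjective a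
    obtain ⟨b, rfl⟩ := J.toQuot_surjective b
    simp only [← toQuot_mul, ← toQuot_star, star_mul]
  star_add a b := by
    obtain ⟨a, rfl⟩ := J.toQuot_surjective a
    obtain ⟨b, rfl⟩ := J.toQuot_surjective b
    simp only [← toQuot_add, ← toQuot_star, star_add]

/-- The quotient map `B → B / J` as a `*`-homomorphism. -/
def quotientMap : B →⋆ₙₐ[ℂ] J.Quot where
  toFun := J.toQuot
  map_smul' c x := J.toQuot_smul c x
  map_zero' := J.toQuot_zero
  map_add' := J.toQuot_add
  map_mul' := J.toQuot_mul
  map_star' := J.toQuot_star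

/-- For ideals `I ⊆ J`, the natural quotient map `B / I → B / J` as a `*`-homomorphism. -/
def factor {I J : CStarIdeal B} (h : I.toSubmodule ≤ J.toSubmodule) :
    I.Quot →⋆ₙₐ[ℂ] J.Quot where
  toFun := Submodule.factor h
  map_smul' c x := (Submodule.factor h).map_smul c x
  map_zero' := (Submodule.factor h).map_zero
  map_add' := (Submodule.factor h).map_add
  map_mul' a b := by
    obtain ⟨a, rfl⟩ := I.toQuot_surjective a
    obtain ⟨b, rfl⟩ := I.toQuot_surjective b
    rfl
  map_star' a := by
    obtain ⟨a, rfl⟩ := I.toQuot_surjective a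
    rfl

theorem factor_toQuot {I J : CStarIdeal B} (h : I.toSubmodule ≤ J.toSubmodule) (b : B) :
    factor h (I.toQuot b) = J.toQuot b := rfl

/-- The closure of the union of an increasing sequence of ideals of `B`. -/
def closureUnion (J : ℕ → CStarIdeal B) (hJ : Monotone fun n => (J n).toSubmodule) :
    CStarIdeal B where
  carrier := closure (⋃ n, ((J n).toSubmodule : Set B))
  zero_mem' := subset_closure (Set.mem_iUnion.2 ⟨0, (J 0).zero_mem⟩)
  add_mem' {x y} hx hy := map_mem_closure₂ continuous_add hx hy fun a ha b hb => by
    obtain ⟨m, hm⟩ := Set.mem_iUnion.1 ha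
    obtain ⟨n, hn⟩ := Set.mem_iUnion.1 hb
    exact Set.mem_iUnion.2 ⟨max m n,
      (J (max m n)).add_mem (hJ (le_max_left m n) hm) (hJ (le_max_right m n) hn)⟩
  smul_mem' c x hx := map_mem_closure (continuous_const_smul c) hx fun a ha => by
    obtain ⟨m, hm⟩ := Set.mem_iUnion.1 ha
    exact Set.mem_iUnion.2 ⟨m, (J m).smul_mem c hm⟩
  mul_mem_left' b x hx := map_mem_closure (continuous_const_mul b) hx fun a ha => by
    obtain ⟨m, hm⟩ := Set.mem_iUnion.1 ha
    exact Set.mem_iUnion.2 ⟨m, (J m).mul_mem_left' b hm⟩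
  mul_mem_right' b x hx := map_mem_closure (f := fun y => y * b) (continuous_mul_const b) hx fun a ha => by
    obtain ⟨m, hm⟩ := Set.mem_iUnion.1 ha
    exact Set.mem_iUnion.2 ⟨m, (J m).mul_mem_right' b hm⟩
  star_mem' {x} hx := map_mem_closure continuous_star hx fun a ha => by
    obtain ⟨m, hm⟩ := Set.mem_iUnion.1 ha
    exact Set.mem_iUnion.2 ⟨m, (J m).star_mem' hm⟩
  isClosed' := isClosed_closure

theorem le_closureUnion (J : ℕ → CStarIdeal B) (hJ : Monotone fun n => (J n).toSubmodule)
    (n : ℕ) : (J n).toSubmodule ≤ (closureUnion J hJ).toSubmodule :=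
  fun x hx => subset_closure (s := ⋃ n, ((J n).toSubmodule : Set B)) (Set.mem_iUnion.2 ⟨n, hx⟩)

/-- The direct sum `⨁ A_n` as an ideal of the product `∏ A_n` of a sequence of C*-algebras: the
product consists of the bounded sequences and the direct sum of the sequences converging to zero
in norm. -/
def directSum (A : ℕ → Type*) [∀ n, NonUnitalCStarAlgebra (A n)] : CStarIdeal (lp A ⊤) where
  carrier := {x | Tendsto (fun n => ‖x n‖) atTop (𝓝 0)}
  zero_mem' := by simp
  add_mem' {x y} hx hy := squeeze_zero (fun n => norm_nonneg _)
    (fun n => norm_add_le (x n) (y n)) (by simpa using Tendsto.add hx hy)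
  smul_mem' c x hx := by
    have h : Tendsto (fun n => ‖c‖ * ‖x n‖) atTop (𝓝 0) := by
      simpa using Tendsto.const_mul ‖c‖ hx
    exact squeeze_zero (fun n => norm_nonneg _) (fun n => norm_smul_le c (x n)) h
  mul_mem_left' a x hx := by
    have h : Tendsto (fun n => ‖a‖ * ‖x n‖) atTop (𝓝 0) := by
      simpa using Tendsto.const_mul ‖a‖ hx
    exact squeeze_zero (fun n => norm_nonneg _) (fun n => (norm_mul_le (a n) (x n)).trans
      (mul_le_mul_of_nonneg_right (lp.norm_apply_le_norm (by simp) a n) (norm_nonneg _))) h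
  mul_mem_right' a x hx := by
    have h : Tendsto (fun n => ‖x n‖ * ‖a‖) atTop (𝓝 0) := by
      simpa using Tendsto.mul_const ‖a‖ hx
    exact squeeze_zero (fun n => norm_nonneg _) (fun n => (norm_mul_le (x n) (a n)).trans
      (mul_le_mul_of_nonneg_left (lp.norm_apply_le_norm (by simp) a n) (norm_nonneg _))) h
  star_mem' {x} hx := by
    have h : (fun n => ‖(star x) n‖) = fun n => ‖x n‖ := by
      funext n
      exact norm_star (x n)
    change Tendsto (fun n => ‖(star x) n‖) atTop (𝓝 0)
    rw [h]
    exact hx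
  isClosed' := by
    refine isClosed_of_closure_subset fun x hx => ?_
    refine Metric.tendsto_atTop.2 fun ε hε => ?_
    obtain ⟨y, hy, hxy⟩ := Metric.mem_closure_iff.1 hx (ε / 2) (half_pos hε)
    obtain ⟨N, hN⟩ := Metric.tendsto_atTop.1 hy (ε / 2) (half_pos hε)
    refine ⟨N, fun n hn => ?_⟩
    have h1 := hN n hn
    have h2 : ‖(x - y) n‖ ≤ ‖x - y‖ := lp.norm_apply_le_norm (by simp) (x - y) n
    have h3 : ‖x n‖ ≤ ‖(x - y) n‖ + ‖y n‖ := by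
      have h := norm_add_le ((x - y) n) (y n)
      simpa using h
    rw [dist_eq_norm] at hxy
    simp only [dist_zero_right, norm_norm] at h1 ⊢
    linarith

end CStarIdeal

/-! ## Semiprojectivity and stability -/

/-- Semiprojectivity of a separable C*-algebra `A`: for every separable C*-algebra `B`, every
increasing sequence `J` of ideals of `B` with closure of the union `J_∞`, and every
`*`-homomorphism `φ : A → B / J_∞`, there are `n` and a `*`-homomorphism `ψ : A → B / J_n` with
`φ = π ∘ ψ`, where `π : B / J_n → B / J_∞` is the natural map. C*-algebras need not be unital and
`*`-homomorphisms need not preserve units. A separable C*-algebra has at most continuum many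
elements, so letting `B` range over `Type` covers all separable C*-algebras up to isomorphism. -/
structure IsSemiprojective (A : Type*) [NonUnitalCStarAlgebra A] : Prop where
  separable : SeparableSpace A
  exists_lift : ∀ (B : Type) [NonUnitalCStarAlgebra B] [SeparableSpace B]
    (J : ℕ → CStarIdeal B) (hJ : Monotone fun n => (J n).toSubmodule)
    (φ : A →⋆ₙₐ[ℂ] (CStarIdeal.closureUnion J hJ).Quot),
    ∃ (n : ℕ) (ψ : A →⋆ₙₐ[ℂ] (J n).Quot),
      (CStarIdeal.factor (CStarIdeal.le_closureUnion J hJ n)).comp ψ = φ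

/-- Matricial (weak) semiprojectivity of a separable C*-algebra `A`: every `*`-homomorphism from
`A` to `∏ M_{k_n}(ℂ) / ⨁ M_{k_n}(ℂ)` lifts to a `*`-homomorphism from `A` to `∏ M_{k_n}(ℂ)`. -/
structure IsMatriciallySemiprojective (A : Type*) [NonUnitalCStarAlgebra A] : Prop where
  separable : SeparableSpace A
  exists_lift : ∀ (k : ℕ → ℕ), (∀ n, 0 < k n) →
    ∀ φ : A →⋆ₙₐ[ℂ] (CStarIdeal.directSum fun n => Matrix (Fin (k n)) (Fin (k n)) ℂ).Quot,
    ∃ ψ : A →⋆ₙₐ[ℂ] lp (fun n => Matrix (Fin (k n)) (Fin (k n)) ℂ) ⊤,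
      (CStarIdeal.quotientMap _).comp ψ = φ

/-- A discrete group is C*-stable if its full group C*-algebra is semiprojective. -/
def IsCStarStable (G : Type*) [Group G] : Prop := IsSemiprojective (GroupCStarAlgebra G)

/-- A discrete group is matricially stable if its full group C*-algebra is matricially
semiprojective. -/
def IsMatriciallyStable (G : Type*) [Group G] : Prop :=
  IsMatriciallySemiprojective (GroupCStarAlgebra G)

/-! ## Ranks -/

/-- The rank of an abelian group: the largest number of elements that are linearly independent
over `ℤ`. -/
def abelianRank (A : Type*) [Group A] [IsMulCommutative A] : Cardinal :=
  letI : CommGroup A := { (inferInstance : Group A) with mul_comm := mul_comm' }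
  Module.rank ℤ (Additive A)

/-- In a nilpotent group of class at most two, the quotient by the center is abelian. -/
theorem isMulCommutative_quotient_center {G : Type*} [Group G] [Group.IsNilpotent G]
    (h : Group.nilpotencyClass G ≤ 2) : IsMulCommutative (G ⧸ Subgroup.center G) := by
  have h1 : Group.nilpotencyClass (G ⧸ Subgroup.center G) ≤ 1 := by
    rw [Group.nilpotencyClass_quotient_center]
    omega
  exact Group.IsNilpotent.nilpotencyClass_le_one_iff.1 h1

end

open scoped commutatorElement

noncomputable section

/-! ## The quotient of a C*-algebra by an ideal is a C*-algebra -/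

/-! The proof turns on the abelianization of `G` modulo torsion, `FreeAbelianization`. Suppose it is
generated by the image of some `x₀`. Then each element is `x₀ ^ n * t` with a nonzero power of `t`
in `[G, G] ⊆ Z(G)`. Roots of central elements are central here, so `G` is abelian; hence `t` is
torsion, `t = 1`, and `G = ⟨x₀⟩` is `ℤ` or trivial. Otherwise there are two independent
homomorphisms `a, b : G → ℤ`, and both (a) and (d) must be refuted. For (a), a rank sum of at most
one makes `Z(G)` or `G/Z(G)` of rank zero, so `G` is abelian of rank at most one, which is too small
for `a` and `b`.

For (d), an integral 2-cocycle `σ` is realised by `N × N` projective representations with multiplier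
`exp(2πiσ/N)`. The multiplier tends to 1, so these matrices define a homomorphism into `∏ M_N / ⨁
M_N`. If it lifted, genuine representations `Q_N` would be asymptotic to the representations `F_N`
of the central extension defined by `σ`. The trace of the argument of `F_N(x) Q_N(x)*` (`phase`) is
eventually additive in `x`, so it vanishes on commutators of the extension. On the central element
`m` it is `N · 2πm/N = 2πm`. Hence no lift exists once some `m ≠ 0` is a product of commutators
(`HeisenbergDatum.not_isMatriciallyStable`). The cup product cocycle `b(g) a(h)` is tried first. If
it fails, it is rationally a coboundary, so `G` maps to a Heisenberg group, and a cocycle of Massey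
product type succeeds because `[x₁, x₂]` is central in `G` but not in the new extension.

For (b) ⇒ (c), homomorphisms need not be unital, so the image of the identity is lifted to a
projection by functional calculus; the image of a generator is then lifted to a unitary of that
corner by polar decomposition. For (c) ⇒ (d), the sequences supported on the first `n` terms form
increasing ideals whose union is dense in `⨁ M_{k_n}`, after restriction to a separable subalgebra.
Functional calculus in quotients requires that `B / J` be a C*-algebra, which is established at the
start. -/

theorem norm_mul_cfc_star_mul_self_le {A : Type*} [CStarAlgebra A] (x : A) {g : ℝ → ℝ}
    (hg : Continuous g) {ε : ℝ} (hε : 0 ≤ ε) (h : ∀ t, ‖g t * t * g t‖ ≤ ε ^ 2) :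
    ‖x * cfc g (star x * x)‖ ≤ ε := by
  have hsa : IsSelfAdjoint (star x * x) := .star_mul_self x
  have hcs : star (cfc g (star x * x)) = cfc g (star x * x) :=
    (cfc_predicate g (star x * x) : IsSelfAdjoint _)
  have h1 : star (x * cfc g (star x * x)) * (x * cfc g (star x * x))
      = cfc (fun t => g t * t * g t) (star x * x) := by
    have hg' : ContinuousOn g (spectrum ℝ (star x * x)) := hg.continuousOn
    rw [cfc_mul (fun t => g t * t) g (star x * x) (hg'.mul continuousOn_id) hg',
      cfc_mul g (fun t => t) (star x * x) hg' continuousOn_id, cfc_id' ℝ (star x * x), star_mul, hcs]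
    simp only [mul_assoc]
  have h2 : ‖cfc (fun t => g t * t * g t) (star x * x)‖ ≤ ε ^ 2 :=
    norm_cfc_le (by positivity) fun t _ => h t
  rw [← h1, CStarRing.norm_star_mul_self, ← sq] at h2
  exact (sq_le_sq₀ (norm_nonneg _) hε).1 h2

namespace CStarIdeal

variable {B : Type*} [NonUnitalCStarAlgebra B]

/-- This gives the C*-identity in `B / J`: any representative `m` of the class of `a* a` bounds the
squared norm of some representative of `a`, up to `ε`. With `j = a* a - m ∈ J`, one cuts `a` down by
`c = g(j* j)`, where `g = 1 - f` and `f(j* j) ∈ J`. Then `‖a c‖² = ‖c m c + c j c‖`, and `j c` is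
small. -/
theorem exists_norm_sub_sq_le (J : CStarIdeal B) (a m : B)
    (hm : star a * a - m ∈ J.toSubmodule) {ε : ℝ} (hε : 0 < ε) :
    ∃ b : B, a - b ∈ J.toSubmodule ∧ ‖b‖ ^ 2 ≤ ‖m‖ + ε := by
  set j := star a * a - m with hj
  have hjJ : star j * j ∈ J.toSubmodule := J.mul_mem_left' _ hm
  set δ := ε ^ 2 with hδ
  have hδ0 : 0 < δ := by positivity
  -- Since `g = 1 - f` vanishes once `|t| ≥ δ = ε²`, one has `g(t)² |t| ≤ ε²`. As `m`, and hence
  -- `j`, need not be self-adjoint, the calculus is applied to `j* j`.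
  let f : ℝ → ℝ := fun t => min (|t| / δ) 1
  let g : ℝ → ℝ := fun t => 1 - f t
  have hf : Continuous f := by fun_prop
  have hg : Continuous g := by fun_prop
  have hf0 : f 0 = 0 := by simp [f]
  have hg0 : ∀ t, 0 ≤ g t := fun t => by simp [g, f]
  have hg1 : ∀ t, g t ≤ 1 := fun t => by
    have : 0 ≤ |t| / δ := by positivity
    simp [g, f, this]
  set s := star j * j with hs
  have hsa : IsSelfAdjoint s := .star_mul_self j
  let e := cfcₙ f s
  have heJ : a * e ∈ J.toSubmodule := by
    refine J.mul_mem_left' _ ?_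
    let S : NonUnitalStarSubalgebra ℂ B :=
      { J.toSubmodule with
        mul_mem' := fun {x y} _ hy => J.mul_mem_left' x hy
        star_mem' := fun hx => J.star_mem' hx }
    have : IsClosed (S : Set B) := J.isClosed'
    exact cfcₙ_mem (s := S) f (a := s) hjJ
  let h : Unitization ℂ B := Unitization.inr s
  have hh : IsSelfAdjoint h := hsa.inr ℂ
  let c := cfc g h
  have hc1 : ‖c‖ ≤ 1 := norm_cfc_le zero_le_one fun t _ => by
    rw [Real.norm_of_nonneg (hg0 t)]; exact hg1 t
  have hcs : star c = c := (cfc_predicate g h : IsSelfAdjoint c)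
  have hce : (Unitization.inr e : Unitization ℂ B) = 1 - c := by
    have h1 : (Unitization.inr e : Unitization ℂ B) = cfc f h :=
      Unitization.real_cfcₙ_eq_cfc_inr s f hf0
    rw [h1, ← cfc_one ℝ h, ← cfc_sub _ _ h]
    congr 1
    funext t
    simp [g]
  have hjc : ‖(Unitization.inr j : Unitization ℂ B) * c‖ ≤ ε := by
    have : h = star (Unitization.inr j) * Unitization.inr j := by
      rw [← Unitization.inr_star, ← Unitization.inr_mul]
    simp only [c, this]
    exact norm_mul_cfc_star_mul_self_le _ hg hε.le fun t => by
      rw [norm_mul, norm_mul, Real.norm_of_nonneg (hg0 t)]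
      by_cases ht : |t| ≤ δ
      · calc g t * ‖t‖ * g t ≤ 1 * δ * 1 := by
              have := hg0 t
              have := hg1 t
              gcongr
              exact ht
          _ = ε ^ 2 := by rw [hδ]; ring
      · have : g t = 0 := by
          have : 1 ≤ |t| / δ := by rw [one_le_div hδ0]; linarith
          simp [g, f, this]
        rw [this]
        simp [sq_nonneg]
  refine ⟨a - a * e, by simpa using heJ, ?_⟩
  have h1 : (Unitization.inr (a - a * e) : Unitization ℂ B) = Unitization.inr a * c := by
    rw [Unitization.inr_sub, Unitization.inr_mul, hce, mul_sub, mul_one]; abel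
  rw [← Unitization.norm_inr (𝕜 := ℂ), h1, sq, ← CStarRing.norm_star_mul_self]
  have h2 : star ((Unitization.inr a : Unitization ℂ B) * c) * (Unitization.inr a * c)
      = c * Unitization.inr m * c + c * (Unitization.inr j * c) := by
    have : star a * a = m + j := by rw [hj]; abel
    rw [star_mul, hcs, mul_assoc, ← mul_assoc (star _), ← Unitization.inr_star,
      ← Unitization.inr_mul, this, Unitization.inr_add]
    simp [mul_add, add_mul, mul_assoc]
  rw [h2]
  refine (norm_add_le _ _).trans (add_le_add ?_ ?_)
  · calc ‖c * Unitization.inr m * c‖ ≤ ‖c‖ * ‖(Unitization.inr m : Unitization ℂ B)‖ * ‖c‖ :=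
          (norm_mul_le _ _).trans (mul_le_mul_of_nonneg_right (norm_mul_le _ _) (norm_nonneg _))
      _ ≤ 1 * ‖m‖ * 1 := by rw [Unitization.norm_inr]; gcongr
      _ = ‖m‖ := by ring
  · calc _ ≤ ‖c‖ * ‖(Unitization.inr j : Unitization ℂ B) * c‖ := norm_mul_le _ _
      _ ≤ 1 * ε := by gcongr
      _ = ε := one_mul ε

variable (J : CStarIdeal B)

instance : NormedAddCommGroup J.Quot :=
  haveI : IsClosed (J.toSubmodule : Set B) := J.isClosed'
  inferInstanceAs (NormedAddCommGroup (B ⧸ J.toSubmodule))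

instance : NormedSpace ℂ J.Quot :=
  inferInstanceAs (NormedSpace ℂ (B ⧸ J.toSubmodule))

instance : CompleteSpace J.Quot :=
  inferInstanceAs (CompleteSpace (B ⧸ J.toSubmodule))

theorem norm_toQuot_le (b : B) : ‖J.toQuot b‖ ≤ ‖b‖ :=
  Submodule.Quotient.norm_mk_le _ b

theorem exists_norm_lt (x : J.Quot) {ε : ℝ} (hε : 0 < ε) :
    ∃ b : B, J.toQuot b = x ∧ ‖b‖ < ‖x‖ + ε :=
  Submodule.Quotient.norm_mk_lt x hε

theorem norm_toQuot_le_of_sub_mem {b c : B} (h : b - c ∈ J.toSubmodule) : ‖J.toQuot b‖ ≤ ‖c‖ := by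
  rw [J.toQuot_eq_toQuot.2 h]
  exact J.norm_toQuot_le c

instance : NonUnitalNormedRing J.Quot where
  __ := (inferInstance : NormedAddCommGroup J.Quot)
  __ := (inferInstance : NonUnitalRing J.Quot)
  norm_mul_le x y := by
    refine le_of_forall_pos_le_add fun ε hε => ?_
    have hcont : Tendsto (fun δ : ℝ => (‖x‖ + δ) * (‖y‖ + δ)) (𝓝[>] 0) (𝓝 (‖x‖ * ‖y‖)) := by
      have : Continuous fun δ : ℝ => (‖x‖ + δ) * (‖y‖ + δ) := by fun_prop
      simpa using (this.tendsto 0).mono_left nhdsWithin_le_nhds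
    obtain ⟨δ, hδ, hδ0⟩ := ((hcont.eventually_lt_const (lt_add_of_pos_right _ hε)).and
      self_mem_nhdsWithin).exists
    obtain ⟨a, rfl, ha⟩ := J.exists_norm_lt x hδ0
    obtain ⟨b, rfl, hb⟩ := J.exists_norm_lt y hδ0
    calc ‖J.toQuot a * J.toQuot b‖ = ‖J.toQuot (a * b)‖ := rfl
      _ ≤ ‖a * b‖ := J.norm_toQuot_le _
      _ ≤ ‖a‖ * ‖b‖ := norm_mul_le _ _
      _ ≤ _ := (mul_le_mul ha.le hb.le (norm_nonneg _)
        (add_nonneg (norm_nonneg _) (le_of_lt hδ0))).trans hδ.le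

instance : NonUnitalCStarAlgebra J.Quot where
  norm_mul_self_le x := by
    obtain ⟨a, rfl⟩ := J.toQuot_surjective x
    rw [← sq]
    refine le_of_forall_pos_le_add fun ε hε => ?_
    -- Here `m` is an almost norm-minimal representative of the class of `a* a`.
    obtain ⟨m, hm, hm'⟩ := J.exists_norm_lt (star (J.toQuot a) * J.toQuot a) (half_pos hε)
    rw [← toQuot_star, ← toQuot_mul] at hm hm'
    obtain ⟨b, hb, hb'⟩ := J.exists_norm_sub_sq_le a m (J.toQuot_eq_toQuot.1 hm.symm) (half_pos hε)
    have := J.norm_toQuot_le_of_sub_mem hb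
    have h2 := pow_le_pow_left₀ (norm_nonneg _) this 2
    rw [← toQuot_star, ← toQuot_mul]
    linarith
  smul_assoc c x y := by
    obtain ⟨a, rfl⟩ := J.toQuot_surjective x
    obtain ⟨b, rfl⟩ := J.toQuot_surjective y
    simp only [smul_eq_mul, ← toQuot_mul, ← toQuot_smul, smul_mul_assoc]
  smul_comm c x y := by
    obtain ⟨a, rfl⟩ := J.toQuot_surjective x
    obtain ⟨b, rfl⟩ := J.toQuot_surjective y
    simp only [smul_eq_mul, ← toQuot_mul, ← toQuot_smul, mul_smul_comm]
  star_smul c x := by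
    obtain ⟨a, rfl⟩ := J.toQuot_surjective x
    simp only [← toQuot_star, ← toQuot_smul, star_smul]

end CStarIdeal

theorem NonUnitalStarAlgHom.continuous_complex {A B : Type*} [NonUnitalCStarAlgebra A]
    [NonUnitalCStarAlgebra B] (φ : A →⋆ₙₐ[ℂ] B) : Continuous φ :=
  AddMonoidHomClass.continuous_of_bound φ 1 fun x => by
    rw [one_mul]; exact NonUnitalStarAlgHom.norm_apply_le φ x

/-! ## The universal property of the full group C*-algebra -/

/-- A unitary representation of a group on a corner of a C*-algebra. -/
structure CornerRep (G A : Type*) [Group G] [NonUnitalCStarAlgebra A] where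
  toFun : G → A
  map_mul' : ∀ g h, toFun (g * h) = toFun g * toFun h
  map_inv' : ∀ g, toFun g⁻¹ = star (toFun g)

/-- Nothing forces the identity of the group to act as a unit; it acts as the projection that
defines the corner. -/
theorem CornerRep.isStarProjection_one {G A : Type*} [Group G] [NonUnitalCStarAlgebra A]
    (f : CornerRep G A) : IsStarProjection (f.toFun 1) :=
  ⟨by rw [IsIdempotentElem, ← f.map_mul', one_mul], by rw [IsSelfAdjoint, ← f.map_inv', inv_one]⟩

namespace GroupStarAlgebra

variable {G A : Type*} [Group G] [NonUnitalCStarAlgebra A]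

/-- The linear extension of a function on the group to the group algebra. -/
def linearLift (f : G → A) : GroupStarAlgebra G →ₗ[ℂ] A :=
  (Finsupp.lsum ℂ fun g => (LinearMap.id : ℂ →ₗ[ℂ] ℂ).smulRight (f g)) ∘ₗ
    (MonoidAlgebra.coeffLinearEquiv ℂ : MonoidAlgebra ℂ G ≃ₗ[ℂ] (G →₀ ℂ)).toLinearMap

theorem linearLift_single (f : G → A) (g : G) (c : ℂ) : linearLift f (single g c) = c • f g := by
  change (Finsupp.lsum ℂ fun g => (LinearMap.id : ℂ →ₗ[ℂ] ℂ).smulRight (f g))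
    (Finsupp.single g c) = _
  simp

/-- The `*`-homomorphism from the group algebra given by a representation. -/
def lift (f : CornerRep G A) : GroupStarAlgebra G →⋆ₙₐ[ℂ] A where
  toFun := linearLift f.toFun
  map_smul' c x := map_smul _ c x
  map_zero' := map_zero _
  map_add' := map_add _
  map_mul' x y := by
    induction x using induction with
    | zero => simp
    | add x x' hx hx' => simp only [add_mul, map_add, hx, hx']
    | single g c =>
      induction y using induction with
      | zero => simp
      | add y y' hy hy' => simp only [mul_add, map_add, hy, hy']
      | single h d =>
        simp only [single_mul_single, linearLift_single, f.map_mul', smul_mul_smul_comm]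
  map_star' x := by
    induction x using induction with
    | zero => simp
    | add x y hx hy => simp only [star_add, map_add, hx, hy]
    | single g c => simp only [star_single, linearLift_single, f.map_inv', star_smul]

theorem lift_single (f : CornerRep G A) (g : G) (c : ℂ) : lift f (single g c) = c • f.toFun g :=
  linearLift_single f.toFun g c

/-- The function `x ↦ ‖π x‖` is a C*-seminorm, and the norm is the supremum of all of these. -/
theorem norm_map_le (π : GroupStarAlgebra G →⋆ₙₐ[ℂ] A) (x : GroupStarAlgebra G) :
    ‖π x‖ ≤ ‖x‖ := by
  let p : Seminorm ℂ (GroupStarAlgebra G) := (normSeminorm ℂ A).comp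
    ({ toFun := π, map_add' := map_add π, map_smul' := fun c x => map_smul π c x } :
      GroupStarAlgebra G →ₗ[ℂ] A)
  have hp : IsCStarSeminorm p :=
    { map_mul_le := fun x y => by
        change ‖π (x * y)‖ ≤ ‖π x‖ * ‖π y‖
        rw [map_mul]; exact norm_mul_le _ _
      map_star := fun x => by
        change ‖π (star x)‖ = ‖π x‖
        rw [map_star, norm_star]
      map_star_mul_self := fun x => by
        change ‖π (star x * x)‖ = ‖π x‖ ^ 2
        rw [map_mul, map_star, CStarRing.norm_star_mul_self, sq] }
  exact le_maxNorm hp x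

end GroupStarAlgebra

namespace GroupCStarAlgebra

variable {G A : Type*} [Group G] [NonUnitalCStarAlgebra A]

/-- The canonical unitary of `C*(G)` attached to a group element. -/
def of (g : G) : GroupCStarAlgebra G := ofAlg (GroupStarAlgebra.single g 1)

theorem of_mul (g h : G) : of (g * h) = of g * of h := by
  rw [of, of, of, ← ofAlg_mul, GroupStarAlgebra.single_mul_single, one_mul]

theorem of_inv (g : G) : of g⁻¹ = star (of g) := by
  rw [of, of, star_ofAlg, GroupStarAlgebra.star_single, star_one]

theorem ofAlg_zero : ofAlg (0 : GroupStarAlgebra G) = 0 := Completion.coe_zero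

theorem ofAlg_single (g : G) (c : ℂ) : ofAlg (GroupStarAlgebra.single g c) = c • of g := by
  rw [of, ← ofAlg_smul, GroupStarAlgebra.smul_single, mul_one]

/-- A `*`-homomorphism from `C*(G)` restricts to a representation of `G`. -/
def cornerRep (φ : GroupCStarAlgebra G →⋆ₙₐ[ℂ] A) : CornerRep G A where
  toFun g := φ (of g)
  map_mul' g h := by rw [of_mul, map_mul]
  map_inv' g := by rw [of_inv, map_star]

theorem hom_ext {φ ψ : GroupCStarAlgebra G →⋆ₙₐ[ℂ] A} (h : ∀ g, φ (of g) = ψ (of g)) :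
    φ = ψ := by
  ext x
  induction x using denseRange_ofAlg.induction_on with
  | hp => exact isClosed_eq φ.continuous_complex ψ.continuous_complex
  | ih x =>
    induction x using GroupStarAlgebra.induction with
    | zero => rw [ofAlg_zero, map_zero, map_zero]
    | add x y hx hy => rw [ofAlg_add, map_add, map_add, hx, hy]
    | single g c => rw [ofAlg_single, map_smul, map_smul, h]

/-- `*`-homomorphisms from `C*(G)` that agree on a generator of a cyclic group are equal. -/
theorem hom_ext_of_zpowers {g₀ : G} (hg₀ : ∀ g, g ∈ Subgroup.zpowers g₀)
    {φ ψ : GroupCStarAlgebra G →⋆ₙₐ[ℂ] A} (h : φ (of g₀) = ψ (of g₀)) : φ = ψ := by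
  have hinv : ∀ g : G, φ (of g) = ψ (of g) → φ (of g⁻¹) = ψ (of g⁻¹) := fun g hg => by
    rw [of_inv, map_star, map_star, hg]
  have hmul : ∀ g h : G, φ (of g) = ψ (of g) → φ (of h) = ψ (of h) →
      φ (of (g * h)) = ψ (of (g * h)) := fun g k hg hk => by
    rw [of_mul, map_mul, map_mul, hg, hk]
  let S : Subgroup G :=
    { carrier := {g | φ (of g) = ψ (of g)}
      mul_mem' := fun {a b} ha hb => hmul a b ha hb
      one_mem' := by
        have := hmul g₀ g₀⁻¹ h (hinv g₀ h)
        rwa [mul_inv_cancel] at this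
      inv_mem' := fun {a} ha => hinv a ha }
  exact hom_ext fun g => (Subgroup.zpowers_le (H := S)).2 h (hg₀ g)

theorem uniformContinuous_lift (f : CornerRep G A) :
    UniformContinuous (GroupStarAlgebra.lift f) :=
  (AddMonoidHomClass.lipschitz_of_bound (GroupStarAlgebra.lift f) 1 fun x => by
    rw [one_mul]; exact GroupStarAlgebra.norm_map_le _ x).uniformContinuous

/-- The extension of a representation to `C*(G)`, as a function. -/
def liftFun (f : CornerRep G A) : GroupCStarAlgebra G → A :=
  Completion.extension (GroupStarAlgebra.lift f)

theorem continuous_liftFun (f : CornerRep G A) : Continuous (liftFun f) :=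
  Completion.continuous_extension

theorem liftFun_ofAlg (f : CornerRep G A) (x : GroupStarAlgebra G) :
    liftFun f (ofAlg x) = GroupStarAlgebra.lift f x :=
  Completion.extension_coe (uniformContinuous_lift f) x

/-- The universal property of `C*(G)`. -/
def lift (f : CornerRep G A) : GroupCStarAlgebra G →⋆ₙₐ[ℂ] A where
  toFun := liftFun f
  map_smul' c x := by
    induction x using denseRange_ofAlg.induction_on with
    | hp =>
      exact isClosed_eq ((continuous_liftFun f).comp (continuous_const_smul c))
        ((continuous_liftFun f).const_smul c)
    | ih x => simp [← ofAlg_smul, liftFun_ofAlg]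
  map_zero' := by rw [← ofAlg_zero, liftFun_ofAlg, map_zero]
  map_add' x y := by
    induction x, y using denseRange_ofAlg.induction_on₂ with
    | hp =>
      exact isClosed_eq ((continuous_liftFun f).comp continuous_add)
        (((continuous_liftFun f).comp continuous_fst).add
          ((continuous_liftFun f).comp continuous_snd))
    | h x y => simp [← ofAlg_add, liftFun_ofAlg]
  map_mul' x y := by
    induction x, y using denseRange_ofAlg.induction_on₂ with
    | hp =>
      exact isClosed_eq ((continuous_liftFun f).comp continuous_mul)
        (((continuous_liftFun f).comp continuous_fst).mul
          ((continuous_liftFun f).comp continuous_snd))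
    | h x y => simp [← ofAlg_mul, liftFun_ofAlg]
  map_star' x := by
    induction x using denseRange_ofAlg.induction_on with
    | hp =>
      exact isClosed_eq ((continuous_liftFun f).comp continuous_star')
        (continuous_star.comp (continuous_liftFun f))
    | ih x => simp [star_ofAlg, liftFun_ofAlg, map_star]

theorem lift_of (f : CornerRep G A) (g : G) : lift f (of g) = f.toFun g := by
  change liftFun f (ofAlg _) = _
  rw [liftFun_ofAlg, GroupStarAlgebra.lift_single, one_smul]

/-- The full group C*-algebra of a countable group is separable. -/
instance [Countable G] : SeparableSpace (GroupCStarAlgebra G) := by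
  rw [← isSeparable_univ_iff]
  have h1 : IsSeparable (Submodule.span ℂ (Set.range (of : G → GroupCStarAlgebra G)) :
      Set (GroupCStarAlgebra G)) :=
    (Set.countable_range _).isSeparable.span
  refine h1.closure.mono ?_
  rw [← denseRange_ofAlg.closure_range]
  refine closure_mono ?_
  rintro _ ⟨x, rfl⟩
  induction x using GroupStarAlgebra.induction with
  | zero => rw [ofAlg_zero]; exact zero_mem _
  | add x y hx hy => rw [ofAlg_add]; exact add_mem hx hy
  | single g c => rw [ofAlg_single]; exact Submodule.smul_mem _ _ (Submodule.subset_span ⟨g, rfl⟩)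

end GroupCStarAlgebra

/-! ## Semiprojectivity implies matricial semiprojectivity -/

theorem NonUnitalStarAlgHom.exists_comp_eq_of_injective {A X Y : Type*} [NonUnitalCStarAlgebra A]
    [NonUnitalCStarAlgebra X] [NonUnitalCStarAlgebra Y] (κ : X →⋆ₙₐ[ℂ] Y)
    (hκ : Function.Injective κ) (φ : A →⋆ₙₐ[ℂ] Y) (h : ∀ a, ∃ x, κ x = φ a) :
    ∃ φ' : A →⋆ₙₐ[ℂ] X, ∀ a, κ (φ' a) = φ a := by
  choose s hs using h
  exact ⟨{ toFun := s
           map_smul' := fun c a => hκ (by rw [hs, map_smul, map_smul, hs]; rfl)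
           map_zero' := hκ (by rw [hs, map_zero, map_zero])
           map_add' := fun a b => hκ (by rw [hs, map_add, map_add, hs, hs])
           map_mul' := fun a b => hκ (by rw [hs, map_mul, map_mul, hs, hs])
           map_star' := fun a => hκ (by rw [hs, map_star, map_star, hs]) }, hs⟩

/-- The linear map underlying a `*`-homomorphism. -/
def NonUnitalStarAlgHom.toLinearMapComplex {A B : Type*} [NonUnitalCStarAlgebra A]
    [NonUnitalCStarAlgebra B] (φ : A →⋆ₙₐ[ℂ] B) : A →ₗ[ℂ] B where
  toFun := φ
  map_add' := map_add φ
  map_smul' c x := map_smul φ c x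

namespace CStarIdeal

variable {B C : Type*} [NonUnitalCStarAlgebra B] [NonUnitalCStarAlgebra C]

/-- A `*`-homomorphism that vanishes on an ideal descends to the quotient. -/
def liftHom (J : CStarIdeal B) (f : B →⋆ₙₐ[ℂ] C) (h : ∀ x ∈ J.toSubmodule, f x = 0) :
    J.Quot →⋆ₙₐ[ℂ] C where
  toFun := J.toSubmodule.liftQ f.toLinearMapComplex h
  map_smul' c x := map_smul _ c x
  map_zero' := map_zero _
  map_add' := map_add _
  map_mul' x y := by
    obtain ⟨x, rfl⟩ := J.toQuot_surjective x
    obtain ⟨y, rfl⟩ := J.toQuot_surjective y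
    exact map_mul f x y
  map_star' x := by
    obtain ⟨x, rfl⟩ := J.toQuot_surjective x
    exact map_star f x

/-- The kernel of a `*`-homomorphism. -/
def ker (f : B →⋆ₙₐ[ℂ] C) : CStarIdeal B where
  carrier := {x | f x = 0}
  zero_mem' := map_zero f
  add_mem' {x y} (hx : f x = 0) (hy : f y = 0) := by
    change f (x + y) = 0
    rw [map_add, hx, hy, add_zero]
  smul_mem' c x (hx : f x = 0) := by
    change f (c • x) = 0
    rw [map_smul, hx, smul_zero]
  mul_mem_left' a x (hx : f x = 0) := by
    change f (a * x) = 0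
    rw [map_mul, hx, mul_zero]
  mul_mem_right' a x (hx : f x = 0) := by
    change f (x * a) = 0
    rw [map_mul, hx, zero_mul]
  star_mem' {x} (hx : f x = 0) := by
    change f (star x) = 0
    rw [map_star, hx, star_zero]
  isClosed' := isClosed_eq f.continuous_complex continuous_const

theorem mem_ker {f : B →⋆ₙₐ[ℂ] C} {x : B} : x ∈ (ker f).toSubmodule ↔ f x = 0 := Iff.rfl

/-- The preimage of a separable set under the quotient map by a separable ideal is separable. -/
theorem isSeparable_preimage (J : CStarIdeal B) (hJ : IsSeparable (J.toSubmodule : Set B))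
    {S : Set J.Quot} (hS : IsSeparable S) : IsSeparable (J.toQuot ⁻¹' S) := by
  obtain ⟨c, hc, hSc⟩ := hS
  choose s hs using J.toQuot_surjective
  have h1 : IsSeparable (Submodule.span ℂ (s '' c ∪ (J.toSubmodule : Set B)) : Set B) :=
    ((hc.image s).isSeparable.union hJ).span
  refine h1.closure.mono fun x hx => Metric.mem_closure_iff.2 fun ε hε => ?_
  obtain ⟨y, hy, hxy⟩ := Metric.mem_closure_iff.1 (hSc hx) (ε / 2) (half_pos hε)
  obtain ⟨b, hb, hb'⟩ := J.exists_norm_lt (J.toQuot x - y) (half_pos hε)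
  rw [dist_eq_norm] at hxy
  refine ⟨x - b, ?_, by rw [dist_eq_norm, sub_sub_cancel]; linarith⟩
  have h2 : (x - b) - s y ∈ J.toSubmodule := by
    rw [← toQuot_eq_toQuot, hs]
    change J.toQuot x - J.toQuot b = y
    rw [hb, sub_sub_cancel]
  have h3 : x - b = ((x - b) - s y) + s y := by abel
  rw [h3]
  exact add_mem (Submodule.subset_span (Or.inr h2))
    (Submodule.subset_span (Or.inl ⟨y, hy, rfl⟩))

end CStarIdeal

section Sequences

variable {M : ℕ → Type*} [∀ n, NonUnitalCStarAlgebra (M n)]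

/-- The truncation of bounded sequences that replaces the first `n` terms by zero. -/
def tailProj (n : ℕ) : lp M ⊤ →⋆ₙₐ[ℂ] lp M ⊤ where
  toFun x := ⟨fun i => if i < n then 0 else x i, memℓp_infty ⟨‖x‖, by
    rintro _ ⟨i, rfl⟩
    dsimp only
    split_ifs
    · simp
    · exact lp.norm_apply_le_norm (by simp) x i⟩⟩
  map_smul' c x := by
    ext i
    change (if i < n then 0 else c • x i) = c • (if i < n then 0 else x i)
    split_ifs <;> simp
  map_zero' := by
    ext i
    change (if i < n then 0 else (0 : M i)) = 0
    split_ifs <;> rfl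
  map_add' x y := by
    ext i
    change (if i < n then 0 else x i + y i) = (if i < n then 0 else x i) + (if i < n then 0 else y i)
    split_ifs <;> simp
  map_mul' x y := by
    ext i
    change (if i < n then 0 else x i * y i) = (if i < n then 0 else x i) * (if i < n then 0 else y i)
    split_ifs <;> simp
  map_star' x := by
    ext i
    change (if i < n then 0 else star (x i)) = star (if i < n then 0 else x i)
    split_ifs <;> simp

theorem tailProj_apply (n : ℕ) (x : lp M ⊤) (i : ℕ) :
    tailProj n x i = if i < n then 0 else x i := rfl

theorem CStarIdeal.mem_directSum {x : lp M ⊤} :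
    x ∈ (CStarIdeal.directSum M).toSubmodule ↔ Tendsto (fun n => ‖x n‖) atTop (𝓝 0) := Iff.rfl

theorem sub_tailProj_mem_directSum (n : ℕ) (x : lp M ⊤) :
    x - tailProj n x ∈ (CStarIdeal.directSum M).toSubmodule := by
  refine CStarIdeal.mem_directSum.2 (tendsto_const_nhds.congr' ?_)
  filter_upwards [eventually_ge_atTop n] with i hi
  rw [lp.coeFn_sub, Pi.sub_apply, tailProj_apply, if_neg (not_lt.2 hi), sub_self, norm_zero]

theorem tailProj_sub_tailProj (n : ℕ) (x : lp M ⊤) : tailProj n (x - tailProj n x) = 0 := by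
  rw [map_sub]
  ext i
  rw [lp.coeFn_sub, Pi.sub_apply, tailProj_apply, tailProj_apply, tailProj_apply]
  split_ifs <;> simp

theorem tendsto_tailProj {x : lp M ⊤} (hx : x ∈ (CStarIdeal.directSum M).toSubmodule) {ε : ℝ}
    (hε : 0 < ε) : ∃ n, ‖tailProj n x‖ ≤ ε := by
  obtain ⟨n, hn⟩ := eventually_atTop.1 ((CStarIdeal.mem_directSum.1 hx).eventually_le_const hε)
  refine ⟨n, lp.norm_le_of_forall_le hε.le fun i => ?_⟩
  rw [tailProj_apply]
  split_ifs with h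
  · simpa using hε.le
  · exact hn i (not_lt.1 h)

theorem isSeparable_directSum [∀ n, SeparableSpace (M n)] :
    IsSeparable ((CStarIdeal.directSum M).toSubmodule : Set (lp M ⊤)) := by
  have h1 : IsSeparable (Submodule.span ℂ (⋃ i, Set.range (lp.single (E := M) ⊤ i)) :
      Set (lp M ⊤)) :=
    (IsSeparable.iUnion fun i => isSeparable_range (lp.isometry_single i).continuous).span
  refine h1.closure.mono fun x hx => Metric.mem_closure_iff.2 fun ε hε => ?_
  obtain ⟨n, hn⟩ := tendsto_tailProj hx (half_pos hε)
  refine ⟨∑ i ∈ Finset.range n, lp.single ⊤ i (x i), ?_, ?_⟩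
  · exact Submodule.sum_mem _ fun i _ =>
      Submodule.subset_span (Set.mem_iUnion.2 ⟨i, x i, rfl⟩)
  · have : x - ∑ i ∈ Finset.range n, lp.single ⊤ i (x i) = tailProj n x := by
      ext i
      rw [lp.coeFn_sub, Pi.sub_apply, tailProj_apply, lp.coeFn_sum, Finset.sum_apply]
      simp only [lp.coeFn_single, Finset.sum_pi_single, Finset.mem_range]
      split_ifs <;> simp
    rw [dist_eq_norm, this]
    linarith

end Sequences

/-- The product is not separable in general, so it is replaced by a separable subalgebra `S`
containing the preimage of the range of `φ`. The ideals `J n` consist of the elements of `S`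
supported on the first `n` terms. A lift to `S / J n` returns to the product by zeroing those terms,
which does not change classes modulo null sequences. -/
theorem IsSemiprojective.exists_lift_directSum {A : Type*} [NonUnitalCStarAlgebra A]
    (hA : IsSemiprojective A) {M : ℕ → Type} [∀ n, NonUnitalCStarAlgebra (M n)]
    [∀ n, SeparableSpace (M n)] (φ : A →⋆ₙₐ[ℂ] (CStarIdeal.directSum M).Quot) :
    ∃ ψ : A →⋆ₙₐ[ℂ] lp M ⊤, (CStarIdeal.quotientMap _).comp ψ = φ := by
  let D := CStarIdeal.directSum M
  change A →⋆ₙₐ[ℂ] D.Quot at φ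
  have := hA.separable
  let S₀ : NonUnitalStarSubalgebra ℂ (lp M ⊤) :=
    (NonUnitalStarAlgHom.range φ).comap D.quotientMap
  let S := S₀.topologicalClosure
  have : IsClosed (S : Set (lp M ⊤)) := S₀.isClosed_topologicalClosure
  have hS₀ : IsSeparable (S₀ : Set (lp M ⊤)) := by
    have h := D.isSeparable_preimage isSeparable_directSum
      (S := Set.range φ) (isSeparable_range φ.continuous_complex)
    exact h
  have : SeparableSpace S := hS₀.closure.separableSpace
  have hDS : ∀ x ∈ D.toSubmodule, x ∈ S := fun x hx => S₀.le_topologicalClosure ⟨0, by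
    rw [map_zero]
    exact (D.toQuot_eq_toQuot.2 (show (0 : lp M ⊤) - x ∈ D.toSubmodule by
      rw [zero_sub]; exact D.toSubmodule.neg_mem hx))⟩
  let ι : S →⋆ₙₐ[ℂ] lp M ⊤ := NonUnitalStarSubalgebraClass.subtype S
  let J : ℕ → CStarIdeal S := fun n => CStarIdeal.ker ((tailProj n).comp ι)
  have hJmem : ∀ n (x : S), x ∈ (J n).toSubmodule ↔ tailProj n (x : lp M ⊤) = 0 :=
    fun n x => Iff.rfl
  have hJ : Monotone fun n => (J n).toSubmodule := fun m n hmn x hx => by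
    rw [hJmem] at hx ⊢
    ext i
    have := congrArg (fun y : lp M ⊤ => y i) hx
    simp only [tailProj_apply, lp.coeFn_zero, Pi.zero_apply] at this ⊢
    split_ifs with h
    · rfl
    · rwa [if_neg (by omega)] at this
  have hJD : ∀ n, ∀ x ∈ (J n).toSubmodule, (x : lp M ⊤) ∈ D.toSubmodule := fun n x hx => by
    have h := sub_tailProj_mem_directSum n (x : lp M ⊤)
    rwa [(hJmem n x).1 hx, sub_zero] at h
  have hcl : ∀ x : S, x ∈ (CStarIdeal.closureUnion J hJ).toSubmodule ↔
      (x : lp M ⊤) ∈ D.toSubmodule := by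
    intro x
    constructor
    · intro hx
      have hc : IsClosed {x : S | (x : lp M ⊤) ∈ D.toSubmodule} :=
        D.isClosed'.preimage continuous_subtype_val
      exact closure_minimal (Set.iUnion_subset fun n y hy => hJD n y hy) hc hx
    · intro hx
      refine Metric.mem_closure_iff.2 fun ε hε => ?_
      obtain ⟨n, hn⟩ := tendsto_tailProj hx (half_pos hε)
      have hy : (x : lp M ⊤) - tailProj n (x : lp M ⊤) ∈ S :=
        hDS _ (sub_tailProj_mem_directSum n (x : lp M ⊤))
      refine ⟨⟨_, hy⟩, Set.mem_iUnion.2 ⟨n, ?_⟩, ?_⟩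
      · exact (hJmem n _).2 (tailProj_sub_tailProj n (x : lp M ⊤))
      · rw [Subtype.dist_eq, dist_eq_norm]
        have h : (x : lp M ⊤) - ((x : lp M ⊤) - tailProj n (x : lp M ⊤)) = tailProj n (x : lp M ⊤) :=
          sub_sub_cancel _ _
        exact (congrArg norm h).trans_lt (by linarith)
  -- The closure of the union of the `J n` is `S ∩ ⨁ M_i`, so `S` modulo it embeds in `∏ M_i / ⨁
  -- M_i`, and `φ` factors through this embedding.
  let κ := (CStarIdeal.closureUnion J hJ).liftHom (D.quotientMap.comp ι) fun x hx => by
    exact D.toQuot_eq_toQuot.2 (by rw [sub_zero]; exact (hcl x).1 hx)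
  have hκ : Function.Injective κ := by
    refine (injective_iff_map_eq_zero κ).2 fun x hx => ?_
    obtain ⟨x, rfl⟩ := CStarIdeal.toQuot_surjective _ x
    have h : (x : lp M ⊤) - 0 ∈ D.toSubmodule := D.toQuot_eq_toQuot.1 hx
    rw [sub_zero] at h
    exact (CStarIdeal.toQuot_eq_toQuot _ (y := 0)).2 (by rw [sub_zero]; exact (hcl x).2 h)
  obtain ⟨φ', hφ'⟩ := NonUnitalStarAlgHom.exists_comp_eq_of_injective κ hκ φ fun a => by
    obtain ⟨x, hx⟩ := D.toQuot_surjective (φ a)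
    have hxS : x ∈ S := S₀.le_topologicalClosure ⟨a, hx.symm⟩
    exact ⟨CStarIdeal.toQuot _ ⟨x, hxS⟩, hx⟩
  obtain ⟨n, ψ, hψ⟩ := hA.exists_lift S J hJ φ'
  let ρ : (J n).Quot →⋆ₙₐ[ℂ] lp M ⊤ := (J n).liftHom ((tailProj n).comp ι) fun x hx => (hJmem n x).1 hx
  refine ⟨ρ.comp ψ, NonUnitalStarAlgHom.ext fun a => ?_⟩
  obtain ⟨b, hb⟩ := (J n).toQuot_surjective (ψ a)
  have h1 : φ' a = CStarIdeal.toQuot _ b := by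
    rw [← hψ, NonUnitalStarAlgHom.comp_apply, ← hb, CStarIdeal.factor_toQuot]
  have h2 : φ a = D.toQuot (b : lp M ⊤) := by rw [← hφ', h1]; rfl
  have h3 : ρ (ψ a) = tailProj n (b : lp M ⊤) := by rw [← hb]; rfl
  change D.toQuot (ρ (ψ a)) = φ a
  rw [h2, h3]
  exact (D.toQuot_eq_toQuot.2 (sub_tailProj_mem_directSum n (b : lp M ⊤))).symm

theorem IsSemiprojective.isMatriciallySemiprojective {A : Type*} [NonUnitalCStarAlgebra A]
    (hA : IsSemiprojective A) : IsMatriciallySemiprojective A where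
  separable := hA.separable
  exists_lift _ _ φ := hA.exists_lift_directSum φ

/-! ## Perturbation of almost projections and almost unitaries -/

/-- The numbers with `t(1 - t) < 3/16` are those outside `[1/4, 3/4]`. So a continuous function
equal to 0 below and 1 above this gap turns `h` into a projection. It fixes 0 and 1, so it leaves
alone any image of `h` that is already a projection. -/
theorem exists_isStarProjection_of_norm_lt {A : Type*} [NonUnitalCStarAlgebra A] {h : A}
    (hsa : IsSelfAdjoint h) (hh : ‖h * h - h‖ < 3 / 16) :
    ∃ P : A, IsStarProjection P ∧ ∀ {B : Type*} [NonUnitalCStarAlgebra B] (π : A →⋆ₙₐ[ℂ] B),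
      IsStarProjection (π h) → π P = π h := by
  let f : ℝ → ℝ := fun t => max 0 (min 1 (2 * t - 1 / 2))
  have hf : Continuous f := by fun_prop
  have hf0 : f 0 = 0 := by norm_num [f]
  have hsp : ∀ t ∈ quasispectrum ℝ h, t ≤ 1 / 4 ∨ 3 / 4 ≤ t := by
    intro t ht
    have h1 : cfcₙ (fun t : ℝ => t * t - t) h = h * h - h := by
      rw [cfcₙ_sub (fun t : ℝ => t * t) (fun t => t) h, cfcₙ_mul (fun t : ℝ => t) (fun t => t) h,
        cfcₙ_id' ℝ h]
    have h2 := norm_apply_le_norm_cfcₙ (fun t : ℝ => t * t - t) h ht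
    rw [h1, Real.norm_eq_abs] at h2
    have h3 := (abs_lt.1 (h2.trans_lt hh)).1
    by_contra! hcon
    nlinarith [mul_pos (sub_pos.2 hcon.1) (sub_pos.2 hcon.2)]
  have hfv : ∀ t, t ≤ 1 / 4 ∨ 3 / 4 ≤ t → f t = 0 ∨ f t = 1 := by
    rintro t (ht | ht)
    · left
      exact max_eq_left ((min_le_right _ _).trans (by linarith))
    · right
      simp only [f]
      rw [min_eq_left (by linarith), max_eq_right zero_le_one]
  refine ⟨cfcₙ f h, ⟨?_, cfcₙ_predicate f h⟩, fun {B} _ π hπ => ?_⟩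
  · rw [IsIdempotentElem, ← cfcₙ_mul f f h]
    refine cfcₙ_congr fun t ht => ?_
    rcases hfv t (hsp t ht) with h0 | h0 <;> simp [h0]
  · rw [NonUnitalStarAlgHomClass.map_cfcₙ (S := ℂ) π f h hf.continuousOn hf0 π.continuous_complex hsa
      hπ.isSelfAdjoint]
    conv_rhs => rw [← cfcₙ_id' ℝ (π h) hπ.isSelfAdjoint]
    refine cfcₙ_congr fun t ht => ?_
    rcases hπ.isIdempotentElem.quasispectrum_subset ℝ ht with h0 | h0
    · rw [h0, hf0]
    · rw [Set.mem_singleton_iff.1 h0]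
      norm_num [f]

theorem isUnit_of_norm_sub_one_lt {A : Type*} [CStarAlgebra A] {x : A} (h : ‖x - 1‖ < 1) :
    IsUnit x := by
  have := isUnit_one_sub_of_norm_lt_one (x := 1 - x) (by rwa [norm_sub_rev])
  rwa [sub_sub_cancel] at this

/-- The unitary part of the polar decomposition of an almost unitary element. -/
theorem exists_unitary_of_norm_lt {U : Type*} [CStarAlgebra U] {z : U}
    (h1 : ‖star z * z - 1‖ < 1) (h2 : ‖z * star z - 1‖ < 1) :
    ∃ w ∈ unitary U, (∀ q, Commute q z → Commute q (star z) → Commute q w) ∧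
      ∀ {V : Type*} [CStarAlgebra V] (π : U →⋆ₐ[ℂ] V), star (π z) * π z = 1 → π w = π z := by
  have hc := isUnit_of_norm_sub_one_lt h1
  have hd := isUnit_of_norm_sub_one_lt h2
  -- The two bounds give a left and a right inverse of `z`; both are needed, since an isometry
  -- satisfies the first.
  have hz : IsUnit z := by
    obtain ⟨a, ha⟩ := hc.exists_left_inv
    obtain ⟨b, hb⟩ := hd.exists_right_inv
    exact isUnit_iff_exists_and_exists.2 ⟨⟨star z * b, by rw [← mul_assoc, hb]⟩,
      ⟨a * star z, by rw [mul_assoc, ha]⟩⟩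
  set c := star z * z with hcdef
  have hsa : IsSelfAdjoint c := .star_mul_self z
  let f : ℝ → ℝ := fun t => (√t)⁻¹
  have hpos : ∀ t ∈ spectrum ℝ c, 0 < t := fun t ht =>
    (spectrum_star_mul_self_nonneg t ht).lt_of_ne fun h0 =>
      spectrum.zero_notMem ℝ hc (h0 ▸ ht)
  have hf : ContinuousOn f (spectrum ℝ c) :=
    Real.continuous_sqrt.continuousOn.inv₀ fun t ht => (Real.sqrt_pos.2 (hpos t ht)).ne'
  set r := cfc f c with hr
  have hrs : star r = r := (cfc_predicate f c : IsSelfAdjoint r)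
  have hrc : r * c * r = 1 := by
    conv_lhs => rw [← cfc_id' ℝ c]
    rw [hr, ← cfc_mul f (fun t => t) c hf continuousOn_id,
      ← cfc_mul (fun t => f t * t) f c (hf.mul continuousOn_id) hf, ← cfc_one ℝ c]
    refine cfc_congr fun t ht => ?_
    have := Real.sqrt_pos.2 (hpos t ht)
    have h3 := Real.mul_self_sqrt (hpos t ht).le
    simp only [f, Pi.one_apply]
    field_simp
    nlinarith
  have hru : IsUnit r := isUnit_iff_exists_and_exists.2
    ⟨⟨c * r, by rw [← mul_assoc, hrc]⟩, ⟨r * c, hrc⟩⟩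
  have hw : star (z * r) * (z * r) = 1 := by
    rw [star_mul, hrs, mul_assoc, ← mul_assoc (star z), ← hcdef, ← mul_assoc, hrc]
  -- The unitary is `z (z* z)^(-1/2)`. Where `π z` is an isometry, `z* z` maps to 1 and the
  -- correction `r` disappears.
  refine ⟨z * r, ⟨hw, ?_⟩, fun q hq hq' => ?_, fun {V} _ π hπ => ?_⟩
  · obtain ⟨y, hy⟩ := (hz.mul hru).exists_right_inv
    have : star (z * r) = y := left_inv_eq_right_inv hw hy
    rw [this, hy]
  · exact hq.mul_right ((hq'.mul_right hq).symm.cfc_real f).symm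
  · have h4 : π c = 1 := by rw [hcdef, map_mul, map_star, hπ]
    have h5 : π r = 1 := by
      rw [hr, StarAlgHomClass.map_cfc (S := ℂ) π f c hf
        (AddMonoidHomClass.continuous_of_bound π 1 fun x => by
          rw [one_mul]; exact NonUnitalStarAlgHom.norm_apply_le π x) hsa
        (by rw [h4]; exact IsSelfAdjoint.one _), h4, cfc_apply_one]
      simp [f]
    rw [map_mul, h5, mul_one]

section Corner

variable {A : Type*} [NonUnitalCStarAlgebra A]

open Unitization in
/-- Completing an element of the corner `P A P` to an element of the unitization. -/
def cornerCompl (P x : A) : Unitization ℂ A := inr x + (1 - inr P)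

open Unitization in
theorem cornerCompl_mul {P x y : A} (hP : IsStarProjection P)
    (hx' : x * P = x) (hy : P * y = y) :
    cornerCompl P x * cornerCompl P y = cornerCompl P (x * y) := by
  have h1 : (inr P : Unitization ℂ A) * inr P = inr P := by
    rw [← inr_mul, hP.isIdempotentElem.eq]
  have h2 : (inr x : Unitization ℂ A) * inr P = inr x := by rw [← inr_mul, hx']
  have h3 : (inr P : Unitization ℂ A) * inr y = inr y := by rw [← inr_mul, hy]
  simp only [cornerCompl, add_mul, mul_add, sub_mul, mul_sub, one_mul, mul_one, h1, h2, h3, inr_mul]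
  abel

open Unitization in
theorem star_cornerCompl {P x : A} (hP : IsStarProjection P) :
    star (cornerCompl P x) = cornerCompl P (star x) := by
  have h : star (inr P : Unitization ℂ A) = inr P := by
    rw [← inr_star, hP.isSelfAdjoint.star_eq]
  simp only [cornerCompl, star_add, star_sub, star_one, inr_star, h]

open Unitization in
theorem starMap_cornerCompl {B : Type*} [NonUnitalCStarAlgebra B] (π : A →⋆ₙₐ[ℂ] B) (P x : A) :
    starMap π (cornerCompl P x) = cornerCompl (π P) (π x) := by
  simp only [cornerCompl, map_add, map_sub, map_one, starMap_inr]

theorem cornerCompl_self (P : A) : cornerCompl P P = 1 := by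
  simp [cornerCompl]

open Unitization in
theorem commute_cornerCompl {P x : A} (hx : P * x = x)
    (hx' : x * P = x) : Commute (inr P) (cornerCompl P x) := by
  simp only [Commute, SemiconjBy, cornerCompl, mul_add, add_mul, mul_sub, sub_mul, mul_one, one_mul,
    ← inr_mul, hx, hx']

open Unitization in
/-- A representation of a cyclic group on a corner sending a generator close to a given
almost unitary of the corner. -/
theorem exists_cornerRep {G : Type*} [Group G] (e : G ≃* Multiplicative ℤ) {P x : A}
    (hP : IsStarProjection P) (hx : P * x = x) (hx' : x * P = x)
    (h1 : ‖star x * x - P‖ < 1) (h2 : ‖x * star x - P‖ < 1) :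
    ∃ f : CornerRep G A, ∀ {B : Type*} [NonUnitalCStarAlgebra B] (π : A →⋆ₙₐ[ℂ] B),
      star (π x) * π x = π P → π (f.toFun (e.symm (Multiplicative.ofAdd 1))) = π x := by
  have hPs := hP.isSelfAdjoint.star_eq
  have hsx : P * star x = star x := by
    conv_rhs => rw [← hx', star_mul, hPs]
  have hsx' : star x * P = star x := by
    conv_rhs => rw [← hx, star_mul, hPs]
  have hnorm : ∀ y : A, ‖cornerCompl P y - 1‖ = ‖y - P‖ := fun y => by
    rw [← norm_inr (𝕜 := ℂ) (y - P), inr_sub, cornerCompl]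
    congr 1
    abel
  -- Adding `1 - P` makes `x` almost unitary in the unitization. The resulting `w` commutes with
  -- `P`, so `g ↦ P w ^ n` is a representation on the corner.
  obtain ⟨w, hw, hcomm, hπ⟩ := exists_unitary_of_norm_lt (z := cornerCompl P x)
    (by rw [star_cornerCompl hP, cornerCompl_mul hP hsx' hx, hnorm]; exact h1)
    (by rw [star_cornerCompl hP, cornerCompl_mul hP hx' hsx, hnorm]; exact h2)
  have hPw : Commute (inr P) w := hcomm _ (commute_cornerCompl hx hx')
    (by rw [star_cornerCompl hP]; exact commute_cornerCompl hsx hsx')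
  let W : unitary (Unitization ℂ A) := ⟨w, hw⟩
  have hPW : ∀ n : ℤ, Commute (inr P : Unitization ℂ A) ((W ^ n : unitary _) : Unitization ℂ A) := by
    let S : Subgroup (unitary (Unitization ℂ A)) :=
      { carrier := {V | Commute (inr P : Unitization ℂ A) (V : Unitization ℂ A)}
        mul_mem' := fun {a b} ha hb => Commute.mul_right (by exact ha) (by exact hb)
        one_mem' := Commute.one_right _
        inv_mem' := fun {a} ha => by
          have h := Commute.star_star (x := (inr P : Unitization ℂ A)) (y := a) ha
          rwa [← inr_star, hPs] at h }
    exact fun n => S.zpow_mem (show W ∈ S from hPw) n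
  -- `inr P * _` has zero scalar part, so its second component loses nothing.
  let F : G → A := fun g => ((inr P : Unitization ℂ A) *
    ((W ^ (Multiplicative.toAdd (e g)) : unitary _) : Unitization ℂ A)).snd
  have hF : ∀ g, (inr (F g) : Unitization ℂ A) = inr P *
      ((W ^ (Multiplicative.toAdd (e g)) : unitary _) : Unitization ℂ A) := fun g => by
    refine Unitization.ext ?_ rfl
    simp
  have hinj : Function.Injective (inr : A → Unitization ℂ A) := inr_injective
  refine ⟨⟨F, fun g h => hinj ?_, fun g => hinj ?_⟩, fun {B} _ π hu => ?_⟩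
  · have h3 : (inr P : Unitization ℂ A) * inr P = inr P := by
      rw [← inr_mul, hP.isIdempotentElem.eq]
    rw [inr_mul, hF, hF, hF, map_mul, toAdd_mul, zpow_add, Submonoid.coe_mul,
      ← mul_assoc (inr P * _), mul_assoc (inr P) _ (inr P), ← (hPW _).eq, ← mul_assoc (inr P) (inr P),
      h3, mul_assoc]
  · rw [inr_star, hF, hF, map_inv, toAdd_inv, (hPW _).eq, star_mul, ← inr_star, hPs, zpow_neg]
    rfl
  · refine (inr_injective (R := ℂ) : Function.Injective (inr : B → Unitization ℂ B)) ?_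
    change inr (π (F _)) = _
    have h3 := hπ (starMap π) (by
      rw [← map_star, ← map_mul, star_cornerCompl hP, cornerCompl_mul hP hsx' hx,
        starMap_cornerCompl, map_mul, map_star, hu, cornerCompl_self])
    rw [← starMap_inr, hF, map_mul]
    simp only [MulEquiv.apply_symm_apply, toAdd_ofAdd, zpow_one]
    change starMap π (inr P) * starMap π w = _
    rw [h3, ← map_mul, (commute_cornerCompl hx hx').eq, cornerCompl, add_mul, sub_mul, one_mul,
      ← inr_mul, ← inr_mul, hx', hP.isIdempotentElem.eq, sub_self, add_zero, starMap_inr]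

end Corner

/-! ## Semiprojectivity of the group C*-algebras of cyclic torsion-free groups -/

namespace CStarIdeal

variable {B : Type*} [NonUnitalCStarAlgebra B] (J : ℕ → CStarIdeal B)
  (hJ : Monotone fun n => (J n).toSubmodule)

include hJ in
theorem eventually_norm_toQuot_lt {b : B} (hb : b ∈ (closureUnion J hJ).toSubmodule) {ε : ℝ}
    (hε : 0 < ε) : ∀ᶠ n in atTop, ‖(J n).toQuot b‖ < ε := by
  obtain ⟨c, hc, hbc⟩ := Metric.mem_closure_iff.1 hb ε hε
  obtain ⟨n, hn⟩ := Set.mem_iUnion.1 hc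
  filter_upwards [eventually_ge_atTop n] with m hm
  rw [dist_eq_norm] at hbc
  refine ((J m).norm_toQuot_le_of_sub_mem (c := b - c) ?_).trans_lt hbc
  rw [sub_sub_cancel]
  exact hJ hm hn

/-- The self-adjoint part of any lift is almost idempotent in some `B / J n`, where it can be
corrected to a projection. Any representative in `B` of that projection remains a projection in all
later quotients. -/
theorem exists_isStarProjection_lift {p : (closureUnion J hJ).Quot} (hp : IsStarProjection p) :
    ∃ b : B, (closureUnion J hJ).toQuot b = p ∧
      ∀ᶠ n in atTop, IsStarProjection ((J n).toQuot b) := by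
  let K := closureUnion J hJ
  change K.Quot at p
  change IsStarProjection p at hp
  obtain ⟨a, ha⟩ := K.toQuot_surjective p
  let h : B := (2⁻¹ : ℂ) • (a + star a)
  have hsa : star h = h := by
    simp only [h, star_smul, star_add, star_star]
    rw [add_comm (star a)]
    congr 1
    simp
  have hhp : K.toQuot h = p := by
    rw [toQuot_smul, toQuot_add, toQuot_star, ha, hp.isSelfAdjoint.star_eq, ← two_smul ℂ p, smul_smul]
    norm_num
  have hmem : h * h - h ∈ K.toSubmodule := by
    rw [← toQuot_eq_toQuot, toQuot_mul, hhp, hp.isIdempotentElem.eq]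
  obtain ⟨n, hn⟩ := (eventually_norm_toQuot_lt J hJ hmem (ε := 3 / 16) (by norm_num)).exists
  obtain ⟨P, hP, hπ⟩ := exists_isStarProjection_of_norm_lt (h := (J n).toQuot h)
    (by rw [IsSelfAdjoint, ← toQuot_star, hsa]) hn
  obtain ⟨b, rfl⟩ := (J n).toQuot_surjective P
  refine ⟨b, ?_, ?_⟩
  · have h1 := hπ (factor (le_closureUnion J hJ n)) (by rw [factor_toQuot]; exact hhp.symm ▸ hp)
    rw [factor_toQuot, factor_toQuot] at h1
    exact h1.trans hhp
  · filter_upwards [eventually_ge_atTop n] with m hm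
    have h1 := hP.map (factor (hJ hm))
    rwa [factor_toQuot] at h1

end CStarIdeal

namespace GroupCStarAlgebra

variable {G : Type*} [Group G]

open CStarIdeal in
theorem isCStarStable_of_subsingleton [Subsingleton G] : IsCStarStable G where
  separable := inferInstance
  exists_lift B _ _ J hJ φ := by
    have hp : IsStarProjection (φ (of 1)) := (cornerRep φ).isStarProjection_one
    obtain ⟨b, hb, hP⟩ := exists_isStarProjection_lift J hJ hp
    obtain ⟨n, hn⟩ := hP.exists
    refine ⟨n, lift ⟨fun _ => (J n).toQuot b, fun _ _ => hn.isIdempotentElem.eq.symm,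
      fun _ => hn.isSelfAdjoint.star_eq.symm⟩, hom_ext fun g => ?_⟩
    rw [NonUnitalStarAlgHom.comp_apply, lift_of, factor_toQuot, hb, Subsingleton.elim g 1]

-- The lift `b` of `φ(1)` is a projection from some stage on. Compressing a lift `a` of the
-- generator to `b a b` puts it in that corner, and at a late enough stage it is close enough to
-- unitary there for polar decomposition.
open CStarIdeal in
theorem isCStarStable_of_mulEquiv_int (e : G ≃* Multiplicative ℤ) : IsCStarStable G where
  separable := by
    have : Countable G := Countable.of_equiv _ e.symm.toEquiv
    infer_instance
  exists_lift B _ _ J hJ φ := by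
    let K := closureUnion J hJ
    change _ →⋆ₙₐ[ℂ] K.Quot at φ
    set g₀ := e.symm (Multiplicative.ofAdd 1) with hg₀
    have hgen : ∀ g, g ∈ Subgroup.zpowers g₀ := fun g => ⟨Multiplicative.toAdd (e g), by
      apply e.injective
      simp [hg₀, ← ofAdd_zsmul]⟩
    have hp : IsStarProjection (φ (of 1)) := (cornerRep φ).isStarProjection_one
    obtain ⟨b, hb, hP⟩ := exists_isStarProjection_lift J hJ hp
    set p := φ (of 1) with hpdef
    set u := φ (of g₀) with hudef
    have hpu : p * u = u := by rw [hpdef, hudef, ← map_mul, ← of_mul, one_mul]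
    have hup : u * p = u := by rw [hpdef, hudef, ← map_mul, ← of_mul, mul_one]
    have huu : star u * u = p := by
      rw [hpdef, hudef, ← map_star, ← map_mul, ← of_inv, ← of_mul, inv_mul_cancel]
    have huu' : u * star u = p := by
      rw [hpdef, hudef, ← map_star, ← map_mul, ← of_inv, ← of_mul, mul_inv_cancel]
    obtain ⟨a, ha⟩ := K.toQuot_surjective u
    have hx : K.toQuot (b * a * b) = u := by
      rw [toQuot_mul, toQuot_mul, hb, ha, hpu, hup]
    have h1 : star (b * a * b) * (b * a * b) - b ∈ K.toSubmodule := by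
      rw [← toQuot_eq_toQuot, toQuot_mul, toQuot_star, hx, huu, hb]
    have h2 : (b * a * b) * star (b * a * b) - b ∈ K.toSubmodule := by
      rw [← toQuot_eq_toQuot, toQuot_mul, toQuot_star, hx, huu', hb]
    obtain ⟨n, hn, hn1, hn2⟩ := (hP.and ((eventually_norm_toQuot_lt J hJ h1 one_pos).and
      (eventually_norm_toQuot_lt J hJ h2 one_pos))).exists
    obtain ⟨f, hf⟩ := exists_cornerRep e (x := (J n).toQuot (b * a * b)) hn
      (by rw [toQuot_mul, toQuot_mul, mul_assoc, ← mul_assoc, hn.isIdempotentElem.eq])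
      (by rw [toQuot_mul, mul_assoc, hn.isIdempotentElem.eq]) hn1 hn2
    refine ⟨n, lift f, hom_ext_of_zpowers hgen ?_⟩
    rw [NonUnitalStarAlgHom.comp_apply, lift_of]
    refine (hf (factor (le_closureUnion J hJ n)) ?_).trans ?_
    · rw [factor_toQuot, factor_toQuot]
      change star (K.toQuot _) * K.toQuot _ = K.toQuot _
      rw [hx, huu, hb]
    · rw [factor_toQuot]
      exact hx

end GroupCStarAlgebra

/-! ## The trace of the argument of a unitary matrix -/

section Phase

variable {n : ℕ}

local notation "𝕄" => Matrix (Fin n) (Fin n) ℂ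

theorem Matrix.det_exp_I_smul_of_isHermitian {H : Matrix (Fin n) (Fin n) ℂ} (hH : H.IsHermitian) :
    (NormedSpace.exp (Complex.I • H)).det = Complex.exp (Complex.I * H.trace) := by
  have hs := hH.spectral_theorem
  set U := hH.eigenvectorUnitary
  rw [Unitary.conjStarAlgAut_apply] at hs
  let V : (Matrix (Fin n) (Fin n) ℂ)ˣ := Unitary.toUnits U
  have hV : Complex.I • H = (V : Matrix (Fin n) (Fin n) ℂ) *
      Matrix.diagonal (fun i => Complex.I * (hH.eigenvalues i : ℂ)) *
        ((V⁻¹ : (Matrix (Fin n) (Fin n) ℂ)ˣ) : Matrix (Fin n) (Fin n) ℂ) := by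
    have h1 : Matrix.diagonal (fun i => Complex.I * (hH.eigenvalues i : ℂ)) =
        Complex.I • Matrix.diagonal (RCLike.ofReal ∘ hH.eigenvalues : Fin n → ℂ) := by
      rw [← Matrix.diagonal_smul]; rfl
    rw [h1, mul_smul_comm, smul_mul_assoc]
    congr 1
  have hdet : (V : Matrix (Fin n) (Fin n) ℂ).det *
      ((V⁻¹ : (Matrix (Fin n) (Fin n) ℂ)ˣ) : Matrix (Fin n) (Fin n) ℂ).det = 1 := by
    rw [← Matrix.det_mul, Units.mul_inv, Matrix.det_one]
  rw [hV, Matrix.exp_units_conj, Matrix.det_mul, Matrix.det_mul, mul_right_comm, hdet, one_mul,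
    Matrix.exp_diagonal, Matrix.det_diagonal, hH.trace_eq_sum_eigenvalues, Finset.mul_sum,
    Complex.exp_sum]
  refine Finset.prod_congr rfl fun i _ => ?_
  rw [Pi.coe_exp, ← Complex.exp_eq_exp_ℂ]
  rfl

/-- The trace of the argument of a unitary matrix. -/
def phase (X : unitary 𝕄) : ℂ := Matrix.trace (Unitary.argSelfAdjoint X : 𝕄)

/-- Thus `phase` is a branch of `-i log det`, continuous on the ball of radius 2 around 1. -/
theorem exp_I_mul_phase {X : unitary 𝕄} (hX : ‖(X : 𝕄) - 1‖ < 2) :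
    Complex.exp (Complex.I * phase X) = (X : 𝕄).det := by
  rw [phase, ← Matrix.det_exp_I_smul_of_isHermitian (Unitary.argSelfAdjoint X).2]
  congr 1
  have h := congrArg (Subtype.val) (expUnitary_argSelfAdjoint hX)
  rw [selfAdjoint.expUnitary_coe] at h
  exact h

theorem continuousOn_phase :
    ContinuousOn (phase : unitary 𝕄 → ℂ) (Metric.ball (1 : unitary 𝕄) 2) := by
  have h : Continuous fun x : selfAdjoint 𝕄 => Matrix.trace (x : 𝕄) :=
    Continuous.matrix_trace continuous_subtype_val
  exact h.comp_continuousOn Unitary.continuousOn_argSelfAdjoint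

theorem phase_one : phase (1 : unitary 𝕄) = 0 := by
  simp [phase, Unitary.argSelfAdjoint_coe]

theorem norm_mul_sub_one_le {A : Type*} [CStarAlgebra A] (X Y : unitary A) :
    ‖((X * Y : unitary A) : A) - 1‖ ≤ ‖(X : A) - 1‖ + ‖(Y : A) - 1‖ := by
  have h : ((X * Y : unitary A) : A) - 1 = ((X : A) - 1) * (Y : A) + ((Y : A) - 1) := by
    rw [Submonoid.coe_mul, sub_mul, one_mul]; abel
  rw [h]
  refine (norm_add_le _ _).trans ?_
  rw [CStarRing.norm_mul_coe_unitary]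

/-- Deform `X` to 1 along `γ t = exp(itA)`, with `A` the argument of `X`. By multiplicativity of the
determinant, the defect of additivity lies in `2πℤ`. The norm bound keeps all unitaries where
`phase` is continuous, so the defect is constant, and at `t = 0` it is zero. -/
theorem phase_mul {X Y : unitary 𝕄} (h : ‖(X : 𝕄) - 1‖ + ‖(Y : 𝕄) - 1‖ < 2) :
    phase (X * Y) = phase X + phase Y := by
  have hX : ‖(X : 𝕄) - 1‖ < 2 := by linarith [norm_nonneg ((Y : 𝕄) - 1)]
  have hY : ‖(Y : 𝕄) - 1‖ < 2 := by linarith [norm_nonneg ((X : 𝕄) - 1)]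
  let γ : unitInterval → unitary 𝕄 := fun t =>
    selfAdjoint.expUnitary ((t : ℝ) • Unitary.argSelfAdjoint X)
  have hγc : Continuous γ := (selfAdjoint.expUnitaryPathToOne (Unitary.argSelfAdjoint X)).continuous
  have hγ : ∀ t, ‖(γ t : 𝕄) - 1‖ ≤ ‖(X : 𝕄) - 1‖ := fun t =>
    Unitary.norm_expUnitary_smul_argSelfAdjoint_sub_one_le X t.2 hX
  have hγ2 : ∀ t, ‖(γ t : 𝕄) - 1‖ < 2 := fun t => (hγ t).trans_lt hX
  have hγY : ∀ t, ‖((γ t * Y : unitary 𝕄) : 𝕄) - 1‖ < 2 := fun t =>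
    (norm_mul_sub_one_le _ _).trans_lt (by linarith [hγ t])
  have hball : ∀ Z : unitary 𝕄, ‖(Z : 𝕄) - 1‖ < 2 → Z ∈ Metric.ball (1 : unitary 𝕄) 2 :=
    fun Z hZ => by
      rw [Metric.mem_ball, Subtype.dist_eq, dist_eq_norm]
      exact hZ
  let f : unitInterval → ℂ := fun t => phase (γ t * Y) - phase (γ t) - phase Y
  have hf : Continuous f :=
    ((continuousOn_phase.comp_continuous (hγc.mul continuous_const) fun t => hball _ (hγY t)).sub
      (continuousOn_phase.comp_continuous hγc fun t => hball _ (hγ2 t))).sub continuous_const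
  have hint : ∀ t, ∃ k : ℤ, f t = 2 * Real.pi * k := fun t => by
    have h1 : Complex.exp (Complex.I * f t) = 1 := by
      have hd : (Y : 𝕄).det ≠ 0 := by rw [← exp_I_mul_phase hY]; exact Complex.exp_ne_zero _
      have hd' : (γ t : 𝕄).det ≠ 0 := by
        rw [← exp_I_mul_phase (hγ2 t)]; exact Complex.exp_ne_zero _
      simp only [f, mul_sub]
      rw [Complex.exp_sub, Complex.exp_sub, exp_I_mul_phase hY, exp_I_mul_phase (hγ2 t),
        exp_I_mul_phase (hγY t), Submonoid.coe_mul, Matrix.det_mul]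
      field_simp
    obtain ⟨k, hk⟩ := Complex.exp_eq_one_iff.1 h1
    refine ⟨k, mul_left_cancel₀ Complex.I_ne_zero ?_⟩
    rw [hk]; ring
  choose k hk using hint
  have hkc : Continuous k := by
    refine Int.isClosedEmbedding_coe_real.isInducing.continuous_iff.2 ?_
    have h1 : ((↑) : ℤ → ℝ) ∘ k = fun t => (f t).re / (2 * Real.pi) := by
      funext t
      have h2 : f t = ((2 * Real.pi * k t : ℝ) : ℂ) := by rw [hk]; push_cast; ring
      rw [h2, Complex.ofReal_re, Function.comp_apply]
      field_simp
    rw [h1]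
    fun_prop
  have h01 : f 1 = f 0 := by
    rw [hk, hk, PreconnectedSpace.constant inferInstance hkc (x := 1) (y := 0)]
  have hγ0 : γ 0 = 1 := (selfAdjoint.expUnitaryPathToOne (Unitary.argSelfAdjoint X)).source
  have hγ1 : γ 1 = X :=
    (selfAdjoint.expUnitaryPathToOne (Unitary.argSelfAdjoint X)).target.trans
      (expUnitary_argSelfAdjoint hX)
  simp only [f, hγ0, hγ1, one_mul, phase_one] at h01
  linear_combination h01

theorem phase_conj {X : unitary 𝕄} (hX : ‖(X : 𝕄) - 1‖ < 2) (U : unitary 𝕄) :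
    phase (U * X * star U) = phase X := by
  have hc : ContinuousOn (fun z => (Complex.arg z : ℂ)) (spectrum ℂ (X : 𝕄)) :=
    Complex.continuous_ofReal.comp_continuousOn
      (Complex.continuousOn_arg.mono
        ((Unitary.spectrum_subset_slitPlane_iff_norm_lt_two X.2).2 hX))
  have hn : IsStarNormal (X : 𝕄) := inferInstance
  have h3 : ((U * X * star U : unitary 𝕄) : 𝕄) = U * X * star (U : 𝕄) := rfl
  have hn' : IsStarNormal ((U * X * star U : unitary 𝕄) : 𝕄) := inferInstance
  have hcont : Continuous (Unitary.conjStarAlgAut ℂ 𝕄 U) := by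
    have : (Unitary.conjStarAlgAut ℂ 𝕄 U : 𝕄 → 𝕄) = fun x => U * x * star (U : 𝕄) := by
      funext x
      exact Unitary.conjStarAlgAut_apply U x
    rw [this]
    fun_prop
  have h1 : cfc (fun z => (Complex.arg z : ℂ)) ((U * X * star U : unitary 𝕄) : 𝕄) =
      U * cfc (fun z => (Complex.arg z : ℂ)) (X : 𝕄) * star (U : 𝕄) := by
    have h2 := StarAlgHomClass.map_cfc (S := ℂ) (Unitary.conjStarAlgAut ℂ 𝕄 U)
      (fun z => (Complex.arg z : ℂ)) (X : 𝕄) hc hcont hn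
      (by rw [Unitary.conjStarAlgAut_apply]; exact hn')
    rw [Unitary.conjStarAlgAut_apply, Unitary.conjStarAlgAut_apply] at h2
    exact h2.symm
  rw [phase, phase, Unitary.argSelfAdjoint_coe, Unitary.argSelfAdjoint_coe, h1,
    Matrix.trace_mul_comm, ← mul_assoc]
  have h4 : star (U : 𝕄) * U = 1 := Unitary.coe_star_mul_self U
  rw [h4, one_mul]

/-- The value is an actual number, not a class modulo `2π`. For `θ = 2πm/n` the determinant is 1,
but the phase is `2πm`. -/
theorem phase_scalar {θ : ℝ} (hθ : |θ| < Real.pi) {X : unitary 𝕄}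
    (hX : (X : 𝕄) = algebraMap ℂ 𝕄 (Complex.exp (θ * Complex.I))) : phase X = n * θ := by
  have harg : Complex.arg (Complex.exp (θ * Complex.I)) = θ := by
    rw [Complex.arg_exp_mul_I, toIocMod_eq_self]
    rw [abs_lt] at hθ
    exact ⟨hθ.1, by linarith [hθ.2]⟩
  rw [phase, Unitary.argSelfAdjoint_coe, hX, cfc_algebraMap, harg]
  simp [Matrix.trace, Matrix.algebraMap_matrix_apply]

end Phase

/-! ## Projective representations of groups mapping to a Heisenberg group -/

/-- A homomorphism from `G` to an integral Heisenberg group, in coordinates. -/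
structure HeisenbergDatum (G : Type*) [Group G] where
  a : G → ℤ
  b : G → ℤ
  c : G → ℤ
  d : ℤ
  a_mul : ∀ g h, a (g * h) = a g + a h
  b_mul : ∀ g h, b (g * h) = b g + b h
  c_mul : ∀ g h, c (g * h) = c g + c h + 2 * d * b g * a h

namespace HeisenbergDatum

variable {G : Type*} [Group G] (D : HeisenbergDatum G)

theorem a_one : D.a 1 = 0 := by simpa using D.a_mul 1 1
theorem b_one : D.b 1 = 0 := by simpa using D.b_mul 1 1
theorem c_one : D.c 1 = 0 := by simpa [D.b_one] using D.c_mul 1 1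

/-- The 2-cocycle of the projective representations attached to the datum. -/
def cocycle (g h : G) : ℤ := D.d * D.b g * D.a h ^ 2 + D.a h * D.c g

/-- The central extension of `G` by `ℤ` attached to the datum. -/
@[ext]
structure Ext {G : Type*} [Group G] (_D : HeisenbergDatum G) where
  fst : G
  snd : ℤ

namespace Ext

variable {D}

instance : Mul D.Ext := ⟨fun x y => ⟨x.fst * y.fst, x.snd + y.snd + D.cocycle x.fst y.fst⟩⟩
instance : One D.Ext := ⟨⟨1, 0⟩⟩
instance : Inv D.Ext := ⟨fun x => ⟨x.fst⁻¹, -x.snd - D.cocycle x.fst⁻¹ x.fst⟩⟩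

theorem mul_fst (x y : D.Ext) : (x * y).fst = x.fst * y.fst := rfl
theorem mul_snd (x y : D.Ext) : (x * y).snd = x.snd + y.snd + D.cocycle x.fst y.fst := rfl
theorem one_fst : (1 : D.Ext).fst = 1 := rfl
theorem one_snd : (1 : D.Ext).snd = 0 := rfl
theorem inv_fst (x : D.Ext) : (x⁻¹).fst = x.fst⁻¹ := rfl
theorem inv_snd (x : D.Ext) : (x⁻¹).snd = -x.snd - D.cocycle x.fst⁻¹ x.fst := rfl

instance : Group D.Ext :=
  Group.ofLeftAxioms
    (fun x y z => by
      ext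
      · simp only [mul_fst, mul_assoc]
      -- This is the cocycle identity: the cross term of `d * b * (a + a')²` cancels the correction
      -- term in `c_mul`.
      · simp only [mul_snd, mul_fst, cocycle, D.a_mul, D.b_mul, D.c_mul]
        ring)
    (fun x => by
      ext
      · simp only [mul_fst, one_fst, one_mul]
      · simp only [mul_snd, one_fst, one_snd, cocycle, D.b_one, D.c_one]
        ring)
    (fun x => by
      ext
      · simp only [mul_fst, one_fst, inv_fst, inv_mul_cancel]
      · simp only [mul_snd, inv_fst, inv_snd, one_snd]
        ring)

end Ext

variable (N : ℕ) [NeZero N]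

/-- The index set `Fin N` as the integers modulo `N`. -/
def idx : Fin N ≃ ZMod N := (ZMod.finEquiv N).toEquiv

/-- The exponent of the root of unity in the projective representation. -/
def expo (x : D.Ext) (k : ZMod N) : ZMod N :=
  x.snd + D.d * D.b x.fst * k ^ 2 + k * D.c x.fst

/-- The monomial matrices of the projective representation. -/
def repMatrix (x : D.Ext) : Matrix (Fin N) (Fin N) ℂ := fun i j =>
  if idx N i = idx N j + D.a x.fst then ZMod.stdAddChar (D.expo N x (idx N j)) else 0

theorem repMatrix_apply (x : D.Ext) (i j : Fin N) : D.repMatrix N x i j =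
    if idx N i = idx N j + D.a x.fst then ZMod.stdAddChar (D.expo N x (idx N j)) else 0 := rfl

/-- The matrix of `x` sends `e_k` to `ω ^ (snd + d b k² + c k) e_(k+a)`. Acting after a shift by
`a'` replaces `k` by `k + a'`. The linear terms in `k` then reproduce the `2 * d * b * a'` of
`c_mul`, and the constant term `d b a'² + a' c` is exactly the cocycle. -/
theorem repMatrix_mul (x y : D.Ext) :
    D.repMatrix N (x * y) = D.repMatrix N x * D.repMatrix N y := by
  ext i j
  rw [Matrix.mul_apply, Finset.sum_eq_single ((idx N).symm (idx N j + D.a y.fst))]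
  · simp only [repMatrix_apply, Equiv.apply_symm_apply, if_true, Ext.mul_fst, D.a_mul]
    push_cast
    have h1 : idx N i = idx N j + (D.a x.fst + D.a y.fst) ↔
        idx N i = idx N j + D.a y.fst + D.a x.fst := by
      rw [add_assoc, add_comm (D.a x.fst : ZMod N)]
    simp only [h1, ite_mul, zero_mul, ← AddChar.map_add_eq_mul]
    congr 2
    simp only [expo, Ext.mul_fst, Ext.mul_snd, D.b_mul, D.c_mul, cocycle]
    push_cast
    ring
  · intro k _ hk
    have h1 : idx N k ≠ idx N j + D.a y.fst := fun h => hk (by rw [← h, Equiv.symm_apply_apply])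
    rw [D.repMatrix_apply N y, if_neg h1, mul_zero]
  · simp

theorem repMatrix_center (m : ℤ) :
    D.repMatrix N ⟨1, m⟩ = algebraMap ℂ _ (ZMod.stdAddChar (m : ZMod N)) := by
  ext i j
  rw [repMatrix_apply, Matrix.algebraMap_matrix_apply]
  simp [D.a_one, expo, D.b_one, D.c_one]

theorem repMatrix_one : D.repMatrix N 1 = 1 := by
  refine (D.repMatrix_center N 0).trans ?_
  rw [Int.cast_zero, AddChar.map_zero_eq_one, map_one]

theorem star_repMatrix_mul_self (x : D.Ext) : star (D.repMatrix N x) * D.repMatrix N x = 1 := by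
  ext i j
  rw [Matrix.mul_apply, Finset.sum_eq_single ((idx N).symm (idx N j + D.a x.fst))]
  · simp only [Matrix.star_apply, repMatrix_apply, Equiv.apply_symm_apply, if_true, add_left_inj,
      (idx N).apply_eq_iff_eq, Matrix.one_apply]
    by_cases h : i = j
    · subst h
      simp only [if_true]
      rw [RCLike.star_def, ← AddChar.map_neg_eq_conj, ← AddChar.map_add_eq_mul, neg_add_cancel,
        AddChar.map_zero_eq_one]
    · rw [if_neg (fun h' => h h'.symm), if_neg h, star_zero, zero_mul]
  · intro k _ hk
    have h1 : idx N k ≠ idx N j + D.a x.fst := fun h => hk (by rw [← h, Equiv.symm_apply_apply])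
    rw [repMatrix_apply (j := j), if_neg h1, mul_zero]
  · simp

/-- The projective representation of `G`, as a unitary representation of the extension. -/
def rep : D.Ext →* unitary (Matrix (Fin N) (Fin N) ℂ) where
  toFun x := ⟨D.repMatrix N x, D.star_repMatrix_mul_self N x,
    mul_eq_one_comm.1 (D.star_repMatrix_mul_self N x)⟩
  map_one' := Subtype.ext (D.repMatrix_one N)
  map_mul' x y := Subtype.ext (D.repMatrix_mul N x y)

theorem coe_rep (x : D.Ext) : (D.rep N x : Matrix (Fin N) (Fin N) ℂ) = D.repMatrix N x := rfl

theorem Ext.center_mul (g : G) (m l : ℤ) : (⟨1, m⟩ * ⟨g, l⟩ : D.Ext) = ⟨g, m + l⟩ := by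
  ext
  · simp [Ext.mul_fst]
  · simp [Ext.mul_snd, cocycle, D.b_one, D.c_one]

theorem stdAddChar_intCast (m : ℤ) : (ZMod.stdAddChar (m : ZMod N) : ℂ) =
    Complex.exp ((2 * Real.pi * m / N : ℝ) * Complex.I) := by
  rw [ZMod.stdAddChar_coe]
  congr 1
  push_cast
  ring

theorem norm_rep_sub_le (g : G) (m l : ℤ) :
    ‖(D.rep N ⟨g, m⟩ : Matrix (Fin N) (Fin N) ℂ) - D.rep N ⟨g, l⟩‖ ≤
      ‖Complex.exp ((2 * Real.pi * (m - l : ℤ) / N : ℝ) * Complex.I) - 1‖ := by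
  have h1 : (⟨g, m⟩ : D.Ext) = ⟨1, m - l⟩ * ⟨g, l⟩ := by
    rw [Ext.center_mul, sub_add_cancel]
  have h2 : (D.rep N ⟨g, m⟩ : Matrix (Fin N) (Fin N) ℂ) - D.rep N ⟨g, l⟩ =
      algebraMap ℂ _ (Complex.exp ((2 * Real.pi * (m - l : ℤ) / N : ℝ) * Complex.I) - 1) *
        D.rep N ⟨g, l⟩ := by
    rw [h1, map_mul, Submonoid.coe_mul, coe_rep, repMatrix_center, map_sub, map_one, sub_mul,
      one_mul, stdAddChar_intCast]
  rw [h2, CStarRing.norm_mul_coe_unitary]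
  exact (norm_algebraMap' _ _).le

/-- Changing the central coordinate by a fixed amount multiplies by the scalar `exp(2πi(m - l)/N)`,
which tends to 1. -/
theorem tendsto_norm_rep_sub (g : G) (m l : ℤ) :
    Tendsto (fun n : ℕ => ‖(D.rep (n + 1) ⟨g, m⟩ : Matrix (Fin (n + 1)) (Fin (n + 1)) ℂ) -
      D.rep (n + 1) ⟨g, l⟩‖) atTop (𝓝 0) := by
  refine squeeze_zero (fun _ => norm_nonneg _) (fun n => D.norm_rep_sub_le (n + 1) g m l) ?_
  have h1 : Tendsto (fun n : ℕ => 2 * Real.pi * (m - l : ℤ) / ((n + 1 : ℕ) : ℝ)) atTop (𝓝 0) :=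
    (tendsto_const_nhds.div_atTop tendsto_natCast_atTop_atTop).comp (tendsto_add_atTop_nat 1)
  have h2 : Continuous fun t : ℝ => ‖Complex.exp ((t : ℂ) * Complex.I) - 1‖ := by fun_prop
  simpa [Function.comp_def] using (h2.tendsto 0).comp h1

end HeisenbergDatum

/-! ## The obstruction to matricial stability -/

section Obstruction

variable {E : Type*} [Group E] {k : ℕ → ℕ}

/-- The ratios `R(x) = F(x) Q(x)*` tend to 1 and satisfy `R(xy) = F(x) R(y) F(x)* · R(x)`. Since
`phase` is invariant under conjugation and additive near 1, `phase ∘ R` is asymptotically a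
homomorphism to an abelian group. -/
theorem eventually_phase_eq_zero_of_mem_commutator
    (F Q : ∀ n, E →* unitary (Matrix (Fin (k n)) (Fin (k n)) ℂ))
    (h : ∀ x, Tendsto (fun n => ‖(F n x : Matrix (Fin (k n)) (Fin (k n)) ℂ) - Q n x‖) atTop (𝓝 0))
    {x : E} (hx : x ∈ commutator E) : ∀ᶠ n in atTop, phase (F n x * star (Q n x)) = 0 := by
  have hR : ∀ n x, ‖((F n x * star (Q n x) : unitary _) : Matrix (Fin (k n)) (Fin (k n)) ℂ) - 1‖ =
      ‖(F n x : Matrix (Fin (k n)) (Fin (k n)) ℂ) - Q n x‖ := fun n x =>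
    (Unitary.norm_sub_eq _ _).symm
  have hadd : ∀ x y, ∀ᶠ n in atTop, phase (F n (x * y) * star (Q n (x * y))) =
      phase (F n x * star (Q n x)) + phase (F n y * star (Q n y)) := by
    intro x y
    filter_upwards [(h x).eventually_lt_const one_pos, (h y).eventually_lt_const one_pos]
      with n hn hm
    rw [← hR] at hn hm
    have h1 : F n (x * y) * star (Q n (x * y)) =
        (F n x * (F n y * star (Q n y)) * star (F n x)) * (F n x * star (Q n x)) := by
      rw [map_mul, map_mul, star_mul]
      simp only [mul_assoc]
      rw [← mul_assoc (star (F n x)) (F n x), Unitary.star_mul_self, one_mul]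
    have h2 : ‖((F n x * (F n y * star (Q n y)) * star (F n x) : unitary _) :
        Matrix (Fin (k n)) (Fin (k n)) ℂ) - 1‖ =
        ‖((F n y * star (Q n y) : unitary _) : Matrix (Fin (k n)) (Fin (k n)) ℂ) - 1‖ := by
      have h3 : ((F n x * (F n y * star (Q n y)) * star (F n x) : unitary _) :
          Matrix (Fin (k n)) (Fin (k n)) ℂ) - 1 =
          F n x * (((F n y * star (Q n y) : unitary _) : Matrix (Fin (k n)) (Fin (k n)) ℂ) - 1) *
            (star (F n x) : unitary _) := by
        rw [mul_sub, sub_mul, mul_one, ← Submonoid.coe_mul, ← Submonoid.coe_mul, ← Submonoid.coe_mul,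
          Unitary.mul_star_self]
        rfl
      rw [h3, CStarRing.norm_mul_coe_unitary, CStarRing.norm_coe_unitary_mul]
    rw [h1, phase_mul (by rw [h2]; linarith), phase_conj (by linarith), add_comm]
  -- Additivity holds only from an index depending on the pair `x, y`; passing to germs at infinity
  -- turns it into an exact homomorphism.
  let Θ : E →* Multiplicative (Germ (atTop : Filter ℕ) ℂ) :=
    MonoidHom.mk' (fun x => Multiplicative.ofAdd
      ((fun n => phase (F n x * star (Q n x)) : ℕ → ℂ) : Germ (atTop : Filter ℕ) ℂ))
      fun x y => congrArg Multiplicative.ofAdd (Germ.coe_eq.2 (hadd x y))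
  have h1 : Θ x = 1 := Abelianization.commutator_subset_ker Θ hx
  exact Germ.coe_eq.1 (congrArg Multiplicative.toAdd h1)

end Obstruction

theorem IsStarProjection.eq_one_of_norm_sub_lt {A : Type*} [CStarAlgebra A] {p : A}
    (hp : IsStarProjection p) (h : ‖p - 1‖ < 1) : p = 1 := by
  have := isUnit_of_norm_sub_one_lt h
  exact this.mul_left_cancel (by rw [mul_one]; exact hp.isIdempotentElem.eq)

open Classical in
/-- The unitary representation given by a representation on a corner, when the corner is
everything (and the trivial representation otherwise). -/
def CornerRep.toUnitary {G A : Type*} [Group G] [CStarAlgebra A] (f : CornerRep G A) :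
    G →* unitary A :=
  if h : f.toFun 1 = 1 then
    { toFun := fun g => ⟨f.toFun g, by
        rw [← f.map_inv', ← f.map_mul', inv_mul_cancel, h], by
        rw [← f.map_inv', ← f.map_mul', mul_inv_cancel, h]⟩
      map_one' := Subtype.ext h
      map_mul' := fun g g' => Subtype.ext (f.map_mul' g g') }
  else 1

theorem CornerRep.coe_toUnitary {G A : Type*} [Group G] [CStarAlgebra A] {f : CornerRep G A}
    (h : f.toFun 1 = 1) (g : G) : (f.toUnitary g : A) = f.toFun g := by
  rw [toUnitary, dif_pos h]
  rfl

namespace HeisenbergDatum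

variable {G : Type*} [Group G] (D : HeisenbergDatum G)

/-- The bounded sequence of values of the projective representations at a group element. -/
def repSeq (g : G) : lp (fun n : ℕ => Matrix (Fin (n + 1)) (Fin (n + 1)) ℂ) ⊤ :=
  ⟨fun n => D.rep (n + 1) ⟨g, 0⟩, memℓp_infty ⟨1, by
    rintro _ ⟨n, rfl⟩
    exact (CStarRing.norm_coe_unitary _).le⟩⟩

theorem repSeq_apply (g : G) (n : ℕ) : D.repSeq g n = D.rep (n + 1) ⟨g, 0⟩ := rfl

/-- The representation of `G` modulo null sequences given by the projective representations. -/
def asymptoticRep : CornerRep G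
    (CStarIdeal.directSum fun n : ℕ => Matrix (Fin (n + 1)) (Fin (n + 1)) ℂ).Quot where
  toFun g := CStarIdeal.toQuot _ (D.repSeq g)
  map_mul' g h := by
    rw [← CStarIdeal.toQuot_mul, CStarIdeal.toQuot_eq_toQuot, CStarIdeal.mem_directSum]
    refine (D.tendsto_norm_rep_sub (g * h) 0 (0 + 0 + D.cocycle g h)).congr fun n => ?_
    rw [lp.coeFn_sub, lp.infty_coeFn_mul, Pi.sub_apply, Pi.mul_apply, repSeq_apply, repSeq_apply,
      repSeq_apply, ← Submonoid.coe_mul, ← map_mul]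
    rfl
  map_inv' g := by
    rw [← CStarIdeal.toQuot_star, CStarIdeal.toQuot_eq_toQuot, CStarIdeal.mem_directSum]
    refine (D.tendsto_norm_rep_sub g⁻¹ 0 (-0 - D.cocycle g⁻¹ g)).congr fun n => ?_
    rw [lp.coeFn_sub, lp.coeFn_star, Pi.sub_apply, Pi.star_apply, repSeq_apply, repSeq_apply]
    have : star (D.rep (n + 1) ⟨g, 0⟩) = D.rep (n + 1) ⟨g⁻¹, -0 - D.cocycle g⁻¹ g⟩ := by
      rw [Unitary.star_eq_inv, ← map_inv]
      rfl
    rw [← this]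
    rfl

theorem phase_rep_center {m : ℤ} :
    ∀ᶠ n : ℕ in atTop, phase (D.rep (n + 1) ⟨1, m⟩) = 2 * Real.pi * m := by
  have h1 : Tendsto (fun n : ℕ => |2 * Real.pi * m / ((n + 1 : ℕ) : ℝ)|) atTop (𝓝 |0|) :=
    ((tendsto_const_nhds.div_atTop tendsto_natCast_atTop_atTop).comp (tendsto_add_atTop_nat 1)).abs
  rw [abs_zero] at h1
  filter_upwards [h1.eventually_lt_const Real.pi_pos] with n hn
  rw [phase_scalar hn (by rw [coe_rep, repMatrix_center, stdAddChar_intCast])]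
  have : ((n + 1 : ℕ) : ℂ) ≠ 0 := Nat.cast_ne_zero.2 n.succ_ne_zero
  push_cast at this ⊢
  field_simp

/-- A lift would give genuine representations of `G` asymptotic to the projective ones. Pulled back
to the extension they are trivial on the centre, so the phase of the ratio at `⟨1, m⟩` is eventually
`2πm`, although it must vanish on commutators. -/
theorem not_isMatriciallyStable {m : ℤ} (hm : m ≠ 0)
    (h : (⟨1, m⟩ : D.Ext) ∈ commutator D.Ext) : ¬ IsMatriciallyStable G := by
  intro hG
  obtain ⟨ψ, hψ⟩ := hG.exists_lift (fun n => n + 1) (fun n => n.succ_pos)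
    (GroupCStarAlgebra.lift D.asymptoticRep)
  have hψ' : ∀ g, Tendsto (fun n => ‖ψ (GroupCStarAlgebra.of g) n - D.rep (n + 1) ⟨g, 0⟩‖)
      atTop (𝓝 0) := fun g => by
    have h1 := congrArg (fun f => f (GroupCStarAlgebra.of g)) hψ
    simp only [GroupCStarAlgebra.lift_of] at h1
    exact CStarIdeal.mem_directSum.1 ((CStarIdeal.toQuot_eq_toQuot _).1 h1)
  let f : ∀ n, CornerRep G (Matrix (Fin (n + 1)) (Fin (n + 1)) ℂ) := fun n =>
    { toFun := fun g => ψ (GroupCStarAlgebra.of g) n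
      map_mul' := fun g h => by
        rw [GroupCStarAlgebra.of_mul, map_mul, lp.infty_coeFn_mul, Pi.mul_apply]
      map_inv' := fun g => by
        rw [GroupCStarAlgebra.of_inv, map_star, lp.coeFn_star, Pi.star_apply] }
  -- The lift need not be unital, but the projection `f n 1` tends to 1 in norm, so it is eventually
  -- equal to 1.
  have hone : ∀ᶠ n in atTop, (f n).toFun 1 = 1 := by
    filter_upwards [(hψ' 1).eventually_lt_const one_pos] with n hn
    refine (f n).isStarProjection_one.eq_one_of_norm_sub_lt ?_
    have h1 : (D.rep (n + 1) ⟨1, 0⟩) = 1 := map_one (D.rep (n + 1))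
    rw [h1] at hn
    exact hn
  let pr : D.Ext →* G := { toFun := Ext.fst, map_one' := rfl, map_mul' := fun _ _ => rfl }
  have hlim : ∀ x : D.Ext, Tendsto (fun n =>
      ‖(D.rep (n + 1) x : Matrix (Fin (n + 1)) (Fin (n + 1)) ℂ) - ((f n).toUnitary.comp pr) x‖)
      atTop (𝓝 0) := fun x => by
    have h1 := (D.tendsto_norm_rep_sub x.fst x.snd 0).add (hψ' x.fst)
    rw [add_zero] at h1
    refine tendsto_of_tendsto_of_tendsto_of_le_of_le' tendsto_const_nhds h1
      (Eventually.of_forall fun _ => norm_nonneg _) ?_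
    filter_upwards [hone] with n hn
    rw [MonoidHom.comp_apply, CornerRep.coe_toUnitary hn,
      norm_sub_rev (ψ (GroupCStarAlgebra.of x.fst) n)]
    exact norm_sub_le_norm_sub_add_norm_sub _ _ _
  have h0 := eventually_phase_eq_zero_of_mem_commutator (k := fun n => n + 1)
    (fun n => D.rep (n + 1)) (fun n => (f n).toUnitary.comp pr) hlim h
  obtain ⟨n, hn, hn'⟩ := (h0.and D.phase_rep_center).exists
  have h1 : (f n).toUnitary.comp pr ⟨1, m⟩ = 1 := map_one (f n).toUnitary
  rw [h1, star_one, mul_one, hn'] at hn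
  simp [Real.pi_ne_zero, hm] at hn

end HeisenbergDatum

/-! ## Homomorphisms from finitely generated groups to the integers -/

section ToInt

variable {G : Type*} [Group G]

/-- The largest torsion-free quotient of the abelianization, written additively. -/
abbrev FreeAbelianization (G : Type*) [Group G] : Type _ :=
  Additive (Abelianization G) ⧸ Submodule.torsion ℤ (Additive (Abelianization G))

/-- The class of a group element in the largest torsion-free abelian quotient. -/
def freeAbelianizationMk (g : G) : FreeAbelianization G :=
  Submodule.Quotient.mk (Additive.ofMul (Abelianization.of g))

theorem freeAbelianizationMk_mul (g h : G) :
    freeAbelianizationMk (g * h) = freeAbelianizationMk g + freeAbelianizationMk h := by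
  rw [freeAbelianizationMk, map_mul, ofMul_mul]
  rfl

theorem freeAbelianizationMk_surjective : Function.Surjective (freeAbelianizationMk (G := G)) := by
  intro x
  obtain ⟨y, rfl⟩ := Submodule.Quotient.mk_surjective _ x
  obtain ⟨g, hg⟩ := QuotientGroup.mk_surjective (Additive.toMul y)
  exact ⟨g, congrArg Submodule.Quotient.mk (congrArg Additive.ofMul hg)⟩

/-- The map to the largest torsion-free abelian quotient as a homomorphism. -/
def freeAbelianizationHom : G →* Multiplicative (FreeAbelianization G) :=
  MonoidHom.mk' (fun g => Multiplicative.ofAdd (freeAbelianizationMk g))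
    fun g h => congrArg Multiplicative.ofAdd (freeAbelianizationMk_mul g h)

theorem freeAbelianizationMk_zpow (g : G) (n : ℤ) :
    freeAbelianizationMk (g ^ n) = n • freeAbelianizationMk g :=
  congrArg Multiplicative.toAdd (map_zpow freeAbelianizationHom g n)

theorem exists_zpow_mem_commutator {g : G} (h : freeAbelianizationMk g = 0) :
    ∃ n : ℤ, n ≠ 0 ∧ g ^ n ∈ commutator G := by
  obtain ⟨n, hn⟩ := (Submodule.mem_torsion_iff _).1 ((Submodule.Quotient.mk_eq_zero _).1 h)
  refine ⟨n, nonZeroDivisors.ne_zero n.2, ?_⟩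
  have h1 : Abelianization.of (g ^ (n : ℤ)) = 1 := by
    rw [map_zpow]
    exact congrArg Additive.toMul hn
  rwa [← MonoidHom.mem_ker, Abelianization.ker_of] at h1

instance [Group.FG G] : Module.Finite ℤ (FreeAbelianization G) := by
  have : Group.FG (Abelianization G) := inferInstanceAs (Group.FG (G ⧸ commutator G))
  have : Module.Finite ℤ (Additive (Abelianization G)) := Module.Finite.iff_addGroup_fg.2 inferInstance
  infer_instance

theorem exists_linearMap_ne_zero [Group.FG G] {z : G}
    (hz : ∀ m : ℤ, z ^ m ∈ commutator G → m = 0) :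
    ∃ f : FreeAbelianization G →ₗ[ℤ] ℤ, f (freeAbelianizationMk z) ≠ 0 := by
  by_contra! h
  have h1 : freeAbelianizationMk z = 0 :=
    (Module.forall_dual_apply_eq_zero_iff ℤ _).1 h
  obtain ⟨n, hn, hn'⟩ := exists_zpow_mem_commutator h1
  exact hn (hz n hn')

/-- Either the largest torsion-free abelian quotient is cyclic or `G` has two independent
homomorphisms to `ℤ`. -/
theorem cyclic_or_exists_independent (G : Type*) [Group G] [Group.FG G] :
    (∃ x₀ : G, ∀ g : G, ∃ n : ℤ, freeAbelianizationMk g = freeAbelianizationMk (x₀ ^ n)) ∨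
    ∃ (f₁ f₂ : FreeAbelianization G →ₗ[ℤ] ℤ) (x₁ x₂ : G), f₁ (freeAbelianizationMk x₁) ≠ 0 ∧
      f₁ (freeAbelianizationMk x₂) = 0 ∧ f₂ (freeAbelianizationMk x₂) ≠ 0 := by
  let B := Module.Free.chooseBasis ℤ (FreeAbelianization G)
  by_cases hB : ∃ i j : Module.Free.ChooseBasisIndex ℤ (FreeAbelianization G), i ≠ j
  · right
    obtain ⟨i, j, hij⟩ := hB
    obtain ⟨x₁, h₁⟩ := freeAbelianizationMk_surjective (B i)
    obtain ⟨x₂, h₂⟩ := freeAbelianizationMk_surjective (B j)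
    -- Two coordinates of a basis, and group elements mapping to the two basis vectors.
    refine ⟨B.coord i, B.coord j, x₁, x₂, ?_, ?_, ?_⟩
    · rw [h₁]; simp
    · rw [h₂]; simp [hij.symm]
    · rw [h₂]; simp
  · left
    push Not at hB
    by_cases hne : Nonempty (Module.Free.ChooseBasisIndex ℤ (FreeAbelianization G))
    · obtain ⟨i⟩ := hne
      obtain ⟨x₀, h₀⟩ := freeAbelianizationMk_surjective (B i)
      refine ⟨x₀, fun g => ⟨B.repr (freeAbelianizationMk g) i, ?_⟩⟩
      rw [freeAbelianizationMk_zpow, h₀]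
      refine B.repr.injective (Finsupp.ext fun j => ?_)
      rw [hB j i]
      simp
    · rw [not_nonempty_iff] at hne
      refine ⟨1, fun g => ⟨0, B.repr.injective (Finsupp.ext fun j => ?_)⟩⟩
      exact isEmptyElim j

end ToInt

/-! ## Construction of the obstruction -/

namespace HeisenbergDatum

variable {G : Type*} [Group G] (D : HeisenbergDatum G)

theorem Ext.center_zpow (m : ℤ) : (⟨1, 1⟩ : D.Ext) ^ m = ⟨1, m⟩ := by
  let f : Multiplicative ℤ →* D.Ext := MonoidHom.mk' (fun m => ⟨1, Multiplicative.toAdd m⟩)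
    fun m l => (Ext.center_mul D 1 _ _).symm
  have h := map_zpow f (Multiplicative.ofAdd 1) m
  rw [← ofAdd_zsmul, smul_eq_mul, mul_one] at h
  exact h.symm

instance [Group.FG G] : Group.FG D.Ext := by
  obtain ⟨S, hS, hfin⟩ := Group.fg_iff.1 (inferInstance : Group.FG G)
  refine Group.fg_iff.2 ⟨insert ⟨1, 1⟩ ((fun g => (⟨g, 0⟩ : D.Ext)) '' S), ?_,
    (hfin.image _).insert _⟩
  set H := Subgroup.closure (insert ⟨1, 1⟩ ((fun g => (⟨g, 0⟩ : D.Ext)) '' S))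
  have hz : ∀ m : ℤ, (⟨1, m⟩ : D.Ext) ∈ H := fun m => by
    rw [← Ext.center_zpow]
    exact H.zpow_mem (Subgroup.subset_closure (Set.mem_insert _ _)) m
  have hH : ∀ x : D.Ext, x ∈ H → ∀ m : ℤ, (⟨x.fst, m⟩ : D.Ext) ∈ H := fun x hx m => by
    have h1 : (⟨x.fst, m⟩ : D.Ext) = ⟨1, m - x.snd⟩ * x := by
      have h2 := Ext.center_mul D x.fst (m - x.snd) x.snd
      rw [sub_add_cancel] at h2
      exact h2.symm
    rw [h1]
    exact H.mul_mem (hz _) hx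
  let K : Subgroup G :=
    { carrier := {g | (⟨g, 0⟩ : D.Ext) ∈ H}
      mul_mem' := fun {g h} hg hh => hH _ (H.mul_mem hg hh) 0
      one_mem' := hz 0
      inv_mem' := fun {g} hg => hH _ (H.inv_mem hg) 0 }
  have hK : K = ⊤ := top_le_iff.1 (hS ▸ (Subgroup.closure_le K).2 fun g hg =>
    Subgroup.subset_closure (Set.mem_insert_of_mem _ ⟨g, hg, rfl⟩))
  exact eq_top_iff.2 fun x _ => hH ⟨x.fst, 0⟩ (show x.fst ∈ K from hK ▸ Subgroup.mem_top _) x.snd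

theorem not_isMatriciallyStable_of_independent [Group.FG G]
    (hcomm : ∀ x y z : G, Commute ⁅x, y⁆ z)
    (f₁ f₂ : FreeAbelianization G →ₗ[ℤ] ℤ) {x₁ x₂ : G} (h₁ : f₁ (freeAbelianizationMk x₁) ≠ 0)
    (h₁₂ : f₁ (freeAbelianizationMk x₂) = 0) (h₂ : f₂ (freeAbelianizationMk x₂) ≠ 0) :
    ¬ IsMatriciallyStable G := by
  set a : G → ℤ := fun g => f₁ (freeAbelianizationMk g) with ha
  set b : G → ℤ := fun g => f₂ (freeAbelianizationMk g) with hb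
  have ha_mul : ∀ g h, a (g * h) = a g + a h := fun g h => by
    simp only [ha, freeAbelianizationMk_mul, map_add]
  have hb_mul : ∀ g h, b (g * h) = b g + b h := fun g h => by
    simp only [hb, freeAbelianizationMk_mul, map_add]
  -- With `d = 0` and `c = b` the cocycle is the cup product `b(g) a(h)`.
  let D : HeisenbergDatum G := ⟨a, b, b, 0, ha_mul, hb_mul, fun g h => by rw [hb_mul]; ring⟩
  by_cases hz : ∀ m : ℤ, (⟨1, 1⟩ : D.Ext) ^ m ∈ commutator D.Ext → m = 0
  -- If no nonzero central power lies in the commutator subgroup of the extension, some homomorphism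
  -- `μ` to `ℤ` is nonzero on the centre: `ν` times the cup product is the coboundary of `g ↦ μ(g,
  -- 0)`, up to sign. Doubling this function gives the even coefficient required by `c_mul`, with `d
  -- = -ν`.
  · obtain ⟨μ, hμ⟩ := exists_linearMap_ne_zero hz
    set ν := μ (freeAbelianizationMk (⟨1, 1⟩ : D.Ext))
    let c : G → ℤ := fun g => 2 * μ (freeAbelianizationMk (⟨g, 0⟩ : D.Ext))
    have hc_mul : ∀ g h, c (g * h) = c g + c h + 2 * (-ν) * b g * a h := by
      intro g h
      have h3 : (⟨g, 0⟩ * ⟨h, 0⟩ : D.Ext) = (⟨1, 1⟩ : D.Ext) ^ (b g * a h) * ⟨g * h, 0⟩ := by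
        rw [Ext.center_zpow, Ext.center_mul]
        ext
        · rfl
        · simp only [Ext.mul_snd, cocycle, D]
          ring
      have h4 := congrArg (fun x => μ (freeAbelianizationMk x)) h3
      simp only [freeAbelianizationMk_mul, freeAbelianizationMk_zpow, map_add, map_smul,
        smul_eq_mul] at h4
      simp only [c]
      linear_combination (-2) * h4
    let D' : HeisenbergDatum G := ⟨a, b, c, -ν, ha_mul, hb_mul, hc_mul⟩
    set y := ⁅x₁, x₂⁆ with hy
    have hyx : y * (x₂ * x₁) = x₁ * x₂ := by
      rw [hy, commutatorElement_def]; group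
    have hay : a y = 0 := by
      have := congrArg a hyx
      simp only [ha_mul] at this
      linarith
    have hby : b y = 0 := by
      have := congrArg b hyx
      simp only [hb_mul] at this
      linarith
    have hcy : c y = 2 * ν * (b x₂ * a x₁) := by
      have := congrArg c hyx
      simp only [hc_mul, ha_mul, hby] at this
      have hax₂ : a x₂ = 0 := h₁₂
      rw [hax₂] at this
      linear_combination this
    have hb1 : b 1 = 0 := D'.b_one
    have hc1 : c 1 = 0 := D'.c_one
    have hmem : (⟨1, a x₁ * c y⟩ : D'.Ext) ∈ commutator D'.Ext := by
      -- As `y` commutes with `x₁` in `G`, the commutator of their lifts is central, with coordinate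
      -- `σ(y, x₁) - σ(x₁, y)`. This equals `a x₁ * c y` because `a` and `b` vanish on `y`.
      have h3 : (⟨1, a x₁ * c y⟩ : D'.Ext) = ⁅(⟨y, 0⟩ : D'.Ext), (⟨x₁, 0⟩ : D'.Ext)⁆ := by
        rw [commutatorElement_def, mul_assoc, ← mul_inv_rev, eq_mul_inv_iff_mul_eq]
        ext
        · simp only [Ext.mul_fst, one_mul]
          exact (hcomm x₁ x₂ x₁).eq.symm
        · simp only [Ext.mul_snd, Ext.mul_fst, cocycle, D', hay, hby, hb1, hc1]
          ring
      rw [h3]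
      exact Subgroup.commutator_mem_commutator (Subgroup.mem_top _) (Subgroup.mem_top _)
    refine D'.not_isMatriciallyStable (mul_ne_zero h₁ ?_) hmem
    rw [hcy]
    exact mul_ne_zero (mul_ne_zero two_ne_zero hμ) (mul_ne_zero h₂ h₁)
  · push Not at hz
    obtain ⟨m, hm, hm0⟩ := hz
    rw [Ext.center_zpow] at hm
    exact D.not_isMatriciallyStable hm0 hm

end HeisenbergDatum

/-! ## Torsion-free nilpotent groups of class at most two -/

section ClassTwo

variable {G : Type*} [Group G]

/-- In class two `t ↦ ⁅t, h⁆` is a homomorphism, so `⁅t, h⁆ ^ n = ⁅t ^ n, h⁆ = 1`, and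
torsion-freeness gives `⁅t, h⁆ = 1`. -/
theorem mem_center_of_zpow_mem_center (hcomm : ∀ x y z : G, Commute ⁅x, y⁆ z)
    (htf : ∀ g : G, IsOfFinOrder g → g = 1) {t : G} {n : ℤ} (hn : n ≠ 0)
    (ht : t ^ n ∈ Subgroup.center G) : t ∈ Subgroup.center G := by
  refine Subgroup.mem_center_iff.2 fun h => ?_
  let f : G →* G := MonoidHom.mk' (fun s => ⁅s, h⁆) fun s r => by
    rw [commutatorElement_mul_left_eq_conj_mul, ← (hcomm r h s).eq, mul_inv_cancel_right]
    exact hcomm r h _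
  have h1 : f t ^ n = 1 := by
    rw [← map_zpow]
    exact commutatorElement_eq_one_iff_mul_comm.2 (Subgroup.mem_center_iff.1 ht h).symm
  have h2 : f t = 1 := htf _ (isOfFinOrder_iff_zpow_eq_one.2 ⟨n, hn, h1⟩)
  exact (commutatorElement_eq_one_iff_mul_comm.1 h2).symm

theorem nonempty_mulEquiv_int_or_subsingleton (hcomm : ∀ x y z : G, Commute ⁅x, y⁆ z)
    (htf : ∀ g : G, IsOfFinOrder g → g = 1) {x₀ : G}
    (hx₀ : ∀ g : G, ∃ n : ℤ, freeAbelianizationMk g = freeAbelianizationMk (x₀ ^ n)) :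
    Nonempty (G ≃* Multiplicative ℤ) ∨ Subsingleton G := by
  have hle : commutator G ≤ Subgroup.center G := by
    rw [commutator_def, Subgroup.commutator_le]
    exact fun x _ y _ => Subgroup.mem_center_iff.2 fun z => (hcomm x y z).eq.symm
  have hdiv : ∀ g : G, ∃ (n k : ℤ), k ≠ 0 ∧ (g * (x₀ ^ n)⁻¹) ^ k ∈ commutator G := fun g => by
    obtain ⟨n, hn⟩ := hx₀ g
    obtain ⟨k, hk⟩ := exists_zpow_mem_commutator (g := g * (x₀ ^ n)⁻¹) (by
      rw [freeAbelianizationMk_mul, hn, ← freeAbelianizationMk_mul, mul_inv_cancel]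
      exact congrArg Multiplicative.toAdd (map_one freeAbelianizationHom))
    exact ⟨n, k, hk⟩
  have hc : ∀ g, ∃ n : ℤ, g * (x₀ ^ n)⁻¹ ∈ Subgroup.center G := fun g => by
    obtain ⟨n, k, hk, hmem⟩ := hdiv g
    exact ⟨n, mem_center_of_zpow_mem_center hcomm htf hk (hle hmem)⟩
  have hab : ∀ g h : G, g * h = h * g := by
    intro g h
    obtain ⟨n, hn⟩ := hc g
    obtain ⟨m, hm⟩ := hc h
    have h1 : Commute (x₀ ^ n) (x₀ ^ m) := Commute.zpow_zpow_self x₀ n m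
    have h2 : Commute (g * (x₀ ^ n)⁻¹ * x₀ ^ n) (h * (x₀ ^ m)⁻¹ * x₀ ^ m) :=
      Commute.mul_left (Subgroup.mem_center_iff.1 hn _).symm
        (Commute.mul_right (Subgroup.mem_center_iff.1 hm _) h1)
    simpa using h2.eq
  have hgen : ∀ g : G, ∃ n : ℤ, x₀ ^ n = g := fun g => by
    obtain ⟨n, k, hk, hmem⟩ := hdiv g
    -- Once `G` is abelian, the power of `g * (x₀ ^ n)⁻¹` lying in the commutator subgroup is
    -- trivial, so that element is torsion and hence 1.
    have h1 : commutator G = ⊥ := by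
      rw [commutator_def, Subgroup.commutator_eq_bot_iff_le_centralizer]
      exact fun x _ y _ => hab y x
    rw [h1, Subgroup.mem_bot] at hmem
    have h2 := htf _ (isOfFinOrder_iff_zpow_eq_one.2 ⟨k, hk, hmem⟩)
    exact ⟨n, (mul_inv_eq_one.1 h2).symm⟩
  by_cases h1 : x₀ = 1
  · right
    refine ⟨fun g h => ?_⟩
    obtain ⟨n, rfl⟩ := hgen g
    obtain ⟨m, rfl⟩ := hgen h
    rw [h1, one_zpow, one_zpow]
  · left
    refine ⟨(MulEquiv.ofBijective (zpowersHom G x₀) ⟨?_, fun g => ?_⟩).symm⟩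
    · refine (injective_iff_map_eq_one _).2 fun n hn => ?_
      rw [zpowersHom_apply] at hn
      by_contra hne
      exact h1 (htf _ (isOfFinOrder_iff_zpow_eq_one.2 ⟨_, fun h => hne (toAdd_eq_zero.1 h), hn⟩))
    · obtain ⟨n, hn⟩ := hgen g
      exact ⟨Multiplicative.ofAdd n, by rw [zpowersHom_apply, toAdd_ofAdd, hn]⟩

end ClassTwo

/-! ## The rank of an abelian group -/

section Rank

variable {A : Type*} [Group A] [IsMulCommutative A]

theorem abelianRank_le_one_of_injective (f : A →* Multiplicative ℤ) (hf : Function.Injective f) :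
    abelianRank A ≤ 1 := by
  let : CommGroup A := { (inferInstance : Group A) with mul_comm := mul_comm' }
  let g : Additive A →ₗ[ℤ] ℤ := (MonoidHom.toAdditiveLeft f).toIntLinearMap
  have h := LinearMap.lift_rank_le_of_injective g hf
  rw [Module.rank_self, Cardinal.lift_one, Cardinal.lift_le_one_iff] at h
  exact h

theorem abelianRank_eq_zero_of_subsingleton [Subsingleton A] : abelianRank A = 0 := by
  let : CommGroup A := { (inferInstance : Group A) with mul_comm := mul_comm' }
  exact rank_subsingleton' ℤ (Additive A)

theorem exists_zpow_eq_one_of_abelianRank_eq_zero (h : abelianRank A = 0) (x : A) :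
    ∃ n : ℤ, n ≠ 0 ∧ x ^ n = 1 := by
  let : CommGroup A := { (inferInstance : Group A) with mul_comm := mul_comm' }
  exact rank_eq_zero_iff.1 h (Additive.ofMul x)

theorem exists_zpow_mul_zpow_eq_one_of_abelianRank_le_one (h : abelianRank A ≤ 1) (x y : A) :
    ∃ n m : ℤ, (n ≠ 0 ∨ m ≠ 0) ∧ x ^ n * y ^ m = 1 := by
  let : CommGroup A := { (inferInstance : Group A) with mul_comm := mul_comm' }
  by_contra! hcon
  have hli : LinearIndependent ℤ ![Additive.ofMul x, Additive.ofMul y] := by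
    refine LinearIndependent.pair_iff.2 fun n m hnm => ?_
    by_contra hne
    exact hcon n m (by tauto) hnm
  have h1 := hli.cardinal_lift_le_rank.trans (Cardinal.lift_le.2 h)
  norm_num at h1

end Rank

theorem theorem4p6 (G : Type*) [Group G] [Group.FG G] [Group.IsNilpotent G]
    (hclass : Group.nilpotencyClass G ≤ 2)
    (htf : ∀ g : G, IsOfFinOrder g → g = 1) :
    List.TFAE [
      (haveI := isMulCommutative_quotient_center hclass
       abelianRank (G ⧸ Subgroup.center G) + abelianRank (Subgroup.center G) ≤ 1),
      Nonempty (G ≃* Multiplicative ℤ) ∨ Subsingleton G,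
      IsCStarStable G,
      IsMatriciallyStable G] := by
  have hquot := isMulCommutative_quotient_center hclass
  have hcomm : ∀ x y z : G, Commute ⁅x, y⁆ z := fun x y z => by
    have h1 : ⁅x, y⁆ ∈ Subgroup.center G := by
      rw [← QuotientGroup.eq_one_iff]
      have h2 : ((⁅x, y⁆ : G) : G ⧸ Subgroup.center G) =
          ⁅(x : G ⧸ Subgroup.center G), (y : G ⧸ Subgroup.center G)⁆ := rfl
      rw [h2, commutatorElement_eq_one_iff_mul_comm]
      exact mul_comm' _ _
    exact (Subgroup.mem_center_iff.1 h1 z).symm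
  tfae_have 1 → 2 := by
    intro h
    rcases cyclic_or_exists_independent G with ⟨x₀, hx₀⟩ | ⟨f₁, f₂, x₁, x₂, h₁, h₁₂, h₂⟩
    · exact nonempty_mulEquiv_int_or_subsingleton hcomm htf hx₀
    exfalso
    have hZ : abelianRank (Subgroup.center G) ≤ 1 := le_add_self.trans h
    have hcases : abelianRank (Subgroup.center G) = 0 ∨ abelianRank (G ⧸ Subgroup.center G) = 0 := by
      by_contra! hcon
      have h3 := Cardinal.one_le_iff_ne_zero.2 hcon.1
      have h4 := Cardinal.one_le_iff_ne_zero.2 hcon.2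
      have h5 : (2 : Cardinal) ≤ 1 := by
        rw [← one_add_one_eq_two]
        exact (add_le_add h4 h3).trans h
      norm_num at h5
    -- A centre of rank zero is trivial, and then so are all commutators. If instead `G/Z(G)` has
    -- rank zero, every element has a central nonzero power.
    have hcen : ∀ g : G, g ∈ Subgroup.center G := by
      rcases hcases with h0 | h0
      · have htriv : ∀ g ∈ Subgroup.center G, g = 1 := fun g hg => by
          obtain ⟨n, hn, hgn⟩ := exists_zpow_eq_one_of_abelianRank_eq_zero h0 ⟨g, hg⟩
          exact htf g (isOfFinOrder_iff_zpow_eq_one.2 ⟨n, hn, congrArg Subtype.val hgn⟩)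
        intro g
        refine Subgroup.mem_center_iff.2 fun k => ?_
        refine (commutatorElement_eq_one_iff_mul_comm.1 (htriv _ ?_))
        exact Subgroup.mem_center_iff.2 fun z => (hcomm k g z).eq.symm
      · intro g
        obtain ⟨n, hn, hgn⟩ := exists_zpow_eq_one_of_abelianRank_eq_zero h0
          (g : G ⧸ Subgroup.center G)
        refine mem_center_of_zpow_mem_center hcomm htf hn ?_
        rwa [← QuotientGroup.eq_one_iff]
    -- A relation between `x₁` and `x₂` exists by rank; evaluating `f₁` kills the exponent of `x₁`,
    -- and then `f₂` kills that of `x₂`.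
    obtain ⟨n, m, hnm, heq⟩ := exists_zpow_mul_zpow_eq_one_of_abelianRank_le_one hZ
      ⟨x₁, hcen x₁⟩ ⟨x₂, hcen x₂⟩
    have heq' : x₁ ^ n * x₂ ^ m = 1 := congrArg Subtype.val heq
    have h3 := congrArg freeAbelianizationMk heq'
    rw [freeAbelianizationMk_mul, freeAbelianizationMk_zpow, freeAbelianizationMk_zpow,
      show freeAbelianizationMk (1 : G) = 0 from
        congrArg Multiplicative.toAdd (map_one freeAbelianizationHom)] at h3
    have h4 := congrArg f₁ h3
    have h5 := congrArg f₂ h3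
    simp only [map_add, map_smul, map_zero, smul_eq_mul, h₁₂, mul_zero, add_zero, mul_eq_zero, h₁,
      or_false] at h4
    simp only [h4, map_add, map_smul, map_zero, smul_eq_mul, zero_mul, zero_add, mul_eq_zero, h₂,
      or_false] at h5
    simp [h4, h5] at hnm
  tfae_have 2 → 3 := by
    rintro (⟨⟨e⟩⟩ | h)
    · exact GroupCStarAlgebra.isCStarStable_of_mulEquiv_int e
    · exact GroupCStarAlgebra.isCStarStable_of_subsingleton
  tfae_have 3 → 4 := fun h => IsSemiprojective.isMatriciallySemiprojective h
  tfae_have 4 → 2 := by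
    intro h
    rcases cyclic_or_exists_independent G with ⟨x₀, hx₀⟩ | ⟨f₁, f₂, x₁, x₂, h₁, h₁₂, h₂⟩
    · exact nonempty_mulEquiv_int_or_subsingleton hcomm htf hx₀
    · exact absurd h
        (HeisenbergDatum.not_isMatriciallyStable_of_independent hcomm f₁ f₂ h₁ h₁₂ h₂)
  tfae_have 2 → 1 := by
    intro h
    obtain ⟨f, hf⟩ : ∃ f : G →* Multiplicative ℤ, Function.Injective f := by
      rcases h with ⟨⟨e⟩⟩ | h
      · exact ⟨e.toMonoidHom, e.injective⟩
      · exact ⟨1, fun _ _ _ => Subsingleton.elim _ _⟩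
    have hcen : ∀ g : G, g ∈ Subgroup.center G := fun g =>
      Subgroup.mem_center_iff.2 fun k => hf (by rw [map_mul, map_mul, mul_comm])
    have : Subsingleton (G ⧸ Subgroup.center G) := by
      rw [QuotientGroup.subsingleton_iff]
      exact eq_top_iff.2 fun g _ => hcen g
    rw [abelianRank_eq_zero_of_subsingleton, zero_add]
    exact abelianRank_le_one_of_injective (f.comp (Subgroup.center G).subtype)
      (hf.comp Subtype.val_injective)
  tfae_finish

end
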